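/- Let $\kappa\in(0,8)\setminus\mathbb{Q}$ and $q=e^{4\pi\mathrm{i}/\kappa}$ (so $q$ is not a root of unity), and put $[2]=q+q^{-1}$. Let $\mathcal{U}_q(\mathfrak{sl}_2)$ be the unital associative $\mathbb{C}$-algebra with generators $E,F,K,K^{-1}$ and relations $KK^{-1}=1=K^{-1}K$, $KE=q^2EK$, $KF=q^{-2}FK$, $EF-FE=\frac{1}{q-q^{-1}}(K-K^{-1})$, with coproduct $\Delta(E)=E\otimes K+1\otimes E$, $\Delta(K)=K\otimes K$, $\Delta(F)=F\otimes 1+K^{-1}\otimes F$. Let $\mathsf{M}_2$ be the representation with basis $e_0,e_1$ and $K.e_0=q\,e_0$, $K.e_1=q^{-1}e_1$, $F.e_0=e_1$, $F.e_1=0$, $E.e_0=0$, $E.e_1=e_0$. The algebra acts on $\mathsf{M}_2^{\otimes n}$ through the iterated coproduct, and $\mathsf{M}_2^{\otimes 0}=\mathbb{C}$ is the trivial representation ($K.1=1$, $E.1=F.1=0$). Let $\hat\pi\colon\mathsf{M}_2\otimes\mathsf{M}_2\to\mathbb{C}$ be the linear map with $\hat\pi(s)=1$ for $s=\frac{1}{q-q^{-1}}(e_1\otimes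 e_0-q\,e_0\otimes e_1)$ and $\hat\pi=0$ on $e_0\otimes e_0$, $q^{-1}e_0\otimes e_1+e_1\otimes e_0$ and $[2]\,e_1\otimes e_1$. For $n\ge 2$ and $1\le j\le n-1$ let $\hat\pi_j=\mathrm{id}^{\otimes(n-1-j)}\otimes\hat\pi\otimes\mathrm{id}^{\otimes(j-1)}\colon\mathsf{M}_2^{\otimes n}\to\mathsf{M}_2^{\otimes(n-2)}$ (the factors $j$ and $j+1$ are counted from the right). For $N\ge 0$ let $\mathrm{LP}_N$ be the set of link patterns of $N$ links, i.e. planar (non-crossing) partitions of $\{1,\dots,2N\}$ into pairs, called links, and let $\mathrm{LP}=\bigsqcup_{N\ge0}\mathrm{LP}_N$; $\mathrm{LP}_0=\{\emptyset\}$. If $\{j,j+1\}\in\alpha\in\mathrm{LP}_N$, let $\alpha/\{j,j+1\}\in\mathrm{LP}_{N-1}$ be the link pattern obtained by removing this link and reducing by two all indices greater than $j+1$. Let $(v_\alpha)_{\alpha\in\mathrm{LP}}$, with $v_\alpha\in\mathsf{M}_2^{\otimes 2N}$ for $\alpha\in\mathrm{LP}_N$, be the collection determined by $v_\emptyset=1$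 and the following equations, for all $\alpha\in\mathrm{LP}_N$, $N\ge0$: $$K.v_\alpha=v_\alpha,\qquad E.v_\alpha=0,\qquad \hat\pi_j(v_\alpha)=\begin{cases}0&\text{if }\{j,j+1\}\notin\alpha,\\ v_{\alpha/\{j,j+1\}}&\text{if }\{j,j+1\}\in\alpha,\end{cases}\quad\text{for all } 1\le j\le 2N-1;$$ there is exactly one such collection. Then there exists a unique collection $(v^{(N)})_{N\in\mathbb{Z}_{\ge0}}$ of vectors $v^{(N)}\in\mathsf{M}_2^{\otimes 2N}$ such that $v^{(0)}=1$ and, for all $N\in\mathbb{Z}_{>0}$, $$K.v^{(N)}=v^{(N)},\qquad E.v^{(N)}=0,\qquad \hat\pi_j(v^{(N)})=v^{(N-1)}\quad\text{for all } j=1,\dots,2N-1.$$ These vectors are given by $$v^{(N)}=\sum_{\alpha\in\mathrm{LP}_N}v_\alpha .$$ -/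

import Mathlib

open scoped TensorProduct

noncomputable section

namespace QSL2

/-! ### The deformation parameter -/

/-- A complex number `q` with `q ≠ 0` and `q ^ 2 ≠ 1`. -/
structure QParam where
  val : ℂ
  ne_zero : val ≠ 0
  sq_ne_one : val ^ 2 ≠ 1

instance : CoeOut QParam ℂ := ⟨QParam.val⟩

theorem QParam.sub_inv_ne_zero (q : QParam) : (q : ℂ) - (q : ℂ)⁻¹ ≠ 0 := by
  intro h
  have h0 := q.ne_zero
  apply q.sq_ne_one
  field_simp at h
  linear_combination h

/-- The parameter `q = exp (4 π i / κ)` for an irrational `κ`. -/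
def qOfKappa (κ : ℝ) (hκ : Irrational κ) : QParam where
  val := Complex.exp (4 * Real.pi * Complex.I / κ)
  ne_zero := Complex.exp_ne_zero _
  sq_ne_one := by
    intro h
    rw [← Complex.exp_nat_mul, Complex.exp_eq_one_iff] at h
    obtain ⟨n, hn⟩ := h
    have hκ0 : (κ : ℂ) ≠ 0 := by
      exact_mod_cast hκ.ne_zero
    have hπ : (Real.pi : ℂ) ≠ 0 := by exact_mod_cast Real.pi_ne_zero
    have hI := Complex.I_ne_zero
    have h1 : (4 : ℂ) = n * κ := by
      field_simp at hn
      push_cast at hn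
      linear_combination hn / 2
    have h2 : (4 : ℝ) = n * κ := by exact_mod_cast h1
    have hn0 : n ≠ 0 := by
      rintro rfl
      norm_num at h2
    have hnR : (n : ℝ) ≠ 0 := by exact_mod_cast hn0
    refine hκ ⟨4 / n, ?_⟩
    push_cast
    rw [h2]
    field_simp

/-! ### The quantum group `U_q(sl₂)` -/

/-- The generators `E`, `F`, `K`, `K⁻¹`. -/
inductive Gen
  | E | F | K | Kinv

open FreeAlgebra in
/-- The defining relations of `U_q(sl₂)`. -/
inductive Rel (q : QParam) : FreeAlgebra ℂ Gen → FreeAlgebra ℂ Gen → Prop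
  | K_mul_Kinv : Rel q (ι ℂ Gen.K * ι ℂ Gen.Kinv) 1
  | Kinv_mul_K : Rel q (ι ℂ Gen.Kinv * ι ℂ Gen.K) 1
  | K_mul_E : Rel q (ι ℂ Gen.K * ι ℂ Gen.E) ((q : ℂ) ^ 2 • (ι ℂ Gen.E * ι ℂ Gen.K))
  | K_mul_F : Rel q (ι ℂ Gen.K * ι ℂ Gen.F) (((q : ℂ) ^ 2)⁻¹ • (ι ℂ Gen.F * ι ℂ Gen.K))
  | E_F : Rel q (ι ℂ Gen.E * ι ℂ Gen.F - ι ℂ Gen.F * ι ℂ Gen.E)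
      (((q : ℂ) - (q : ℂ)⁻¹)⁻¹ • (ι ℂ Gen.K - ι ℂ Gen.Kinv))

/-- The quantum group `U_q(sl₂)` as an associative unital algebra over `ℂ`. -/
abbrev Uq (q : QParam) : Type := RingQuot (Rel q)

/-- The image of a generator in `U_q(sl₂)`. -/
def gen (q : QParam) (g : Gen) : Uq q := RingQuot.mkAlgHom ℂ (Rel q) (FreeAlgebra.ι ℂ g)

/-- The universal property: an assignment on the generators which respects the relations extends
to an algebra homomorphism. -/
def liftHom (q : QParam) {A : Type} [Ring A] [Algebra ℂ A] (f : Gen → A)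
    (hKK' : f Gen.K * f Gen.Kinv = 1) (hK'K : f Gen.Kinv * f Gen.K = 1)
    (hKE : f Gen.K * f Gen.E = (q : ℂ) ^ 2 • (f Gen.E * f Gen.K))
    (hKF : f Gen.K * f Gen.F = ((q : ℂ) ^ 2)⁻¹ • (f Gen.F * f Gen.K))
    (hEF : f Gen.E * f Gen.F - f Gen.F * f Gen.E =
      ((q : ℂ) - (q : ℂ)⁻¹)⁻¹ • (f Gen.K - f Gen.Kinv)) :
    Uq q →ₐ[ℂ] A :=
  RingQuot.liftAlgHom ℂ ⟨FreeAlgebra.lift ℂ f, by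
    intro x y h
    cases h <;> simpa⟩

theorem liftHom_gen (q : QParam) {A : Type} [Ring A] [Algebra ℂ A] (f : Gen → A)
    (h1 h2 h3 h4 h5) (g : Gen) : liftHom q f h1 h2 h3 h4 h5 (gen q g) = f g := by
  simp [liftHom, gen]

section relations
variable (q : QParam)

theorem K_mul_Kinv : gen q Gen.K * gen q Gen.Kinv = 1 := by
  simpa [gen] using RingQuot.mkAlgHom_rel ℂ (Rel.K_mul_Kinv (q := q))

theorem Kinv_mul_K : gen q Gen.Kinv * gen q Gen.K = 1 := by
  simpa [gen] using RingQuot.mkAlgHom_rel ℂ (Rel.Kinv_mul_K (q := q))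

theorem K_mul_E : gen q Gen.K * gen q Gen.E = (q : ℂ) ^ 2 • (gen q Gen.E * gen q Gen.K) := by
  simpa [gen] using RingQuot.mkAlgHom_rel ℂ (Rel.K_mul_E (q := q))

theorem K_mul_F :
    gen q Gen.K * gen q Gen.F = ((q : ℂ) ^ 2)⁻¹ • (gen q Gen.F * gen q Gen.K) := by
  simpa [gen] using RingQuot.mkAlgHom_rel ℂ (Rel.K_mul_F (q := q))

theorem E_F : gen q Gen.E * gen q Gen.F - gen q Gen.F * gen q Gen.E =
    ((q : ℂ) - (q : ℂ)⁻¹)⁻¹ • (gen q Gen.K - gen q Gen.Kinv) := by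
  simpa [gen] using RingQuot.mkAlgHom_rel ℂ (Rel.E_F (q := q))

theorem E_mul_Kinv :
    gen q Gen.E * gen q Gen.Kinv = (q : ℂ) ^ 2 • (gen q Gen.Kinv * gen q Gen.E) := by
  have h : gen q Gen.Kinv * (gen q Gen.K * gen q Gen.E) * gen q Gen.Kinv =
      gen q Gen.Kinv * ((q : ℂ) ^ 2 • (gen q Gen.E * gen q Gen.K)) * gen q Gen.Kinv := by
    rw [K_mul_E]
  rw [← mul_assoc, Kinv_mul_K, one_mul, mul_smul_comm, smul_mul_assoc, mul_assoc, mul_assoc,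
    K_mul_Kinv, mul_one] at h
  exact h

end relations

/-- The values of the coproduct on the generators:
`Δ(E) = E ⊗ K + 1 ⊗ E`, `Δ(F) = F ⊗ 1 + K⁻¹ ⊗ F`, `Δ(K) = K ⊗ K`. -/
def comulGen (q : QParam) : Gen → Uq q ⊗[ℂ] Uq q
  | Gen.E => gen q Gen.E ⊗ₜ gen q Gen.K + 1 ⊗ₜ gen q Gen.E
  | Gen.F => gen q Gen.F ⊗ₜ 1 + gen q Gen.Kinv ⊗ₜ gen q Gen.F
  | Gen.K => gen q Gen.K ⊗ₜ gen q Gen.K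
  | Gen.Kinv => gen q Gen.Kinv ⊗ₜ gen q Gen.Kinv

/-- The coproduct `Δ : U_q(sl₂) → U_q(sl₂) ⊗ U_q(sl₂)`. -/
def comul (q : QParam) : Uq q →ₐ[ℂ] Uq q ⊗[ℂ] Uq q :=
  liftHom q (comulGen q)
    (by simp [comulGen, K_mul_Kinv, Algebra.TensorProduct.one_def])
    (by simp [comulGen, Kinv_mul_K, Algebra.TensorProduct.one_def])
    (by
      simp [comulGen, mul_add, add_mul, K_mul_E, TensorProduct.tmul_smul,
        TensorProduct.smul_tmul', smul_add])
    (by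
      simp [comulGen, mul_add, add_mul, K_mul_F, K_mul_Kinv, Kinv_mul_K, TensorProduct.tmul_smul,
        TensorProduct.smul_tmul', smul_add])
    (by
      have hq : (q : ℂ) ^ 2 ≠ 0 := pow_ne_zero 2 q.ne_zero
      have hmid : (gen q Gen.E * gen q Gen.Kinv) ⊗ₜ[ℂ] (gen q Gen.K * gen q Gen.F) =
          (gen q Gen.Kinv * gen q Gen.E) ⊗ₜ[ℂ] (gen q Gen.F * gen q Gen.K) := by
        rw [E_mul_Kinv, K_mul_F, TensorProduct.tmul_smul, TensorProduct.smul_tmul', smul_smul,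
          inv_mul_cancel₀ hq, one_smul]
      have h1 : (gen q Gen.E * gen q Gen.F) ⊗ₜ[ℂ] gen q Gen.K -
          (gen q Gen.F * gen q Gen.E) ⊗ₜ[ℂ] gen q Gen.K =
          ((q : ℂ) - (q : ℂ)⁻¹)⁻¹ • (gen q Gen.K ⊗ₜ[ℂ] gen q Gen.K -
            gen q Gen.Kinv ⊗ₜ[ℂ] gen q Gen.K) := by
        rw [← TensorProduct.sub_tmul, E_F, ← TensorProduct.smul_tmul', TensorProduct.sub_tmul]
      have h2 : gen q Gen.Kinv ⊗ₜ[ℂ] (gen q Gen.E * gen q Gen.F) -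
          gen q Gen.Kinv ⊗ₜ[ℂ] (gen q Gen.F * gen q Gen.E) =
          ((q : ℂ) - (q : ℂ)⁻¹)⁻¹ • (gen q Gen.Kinv ⊗ₜ[ℂ] gen q Gen.K -
            gen q Gen.Kinv ⊗ₜ[ℂ] gen q Gen.Kinv) := by
        rw [← TensorProduct.tmul_sub, E_F, TensorProduct.tmul_smul, TensorProduct.tmul_sub]
      simp only [comulGen, mul_add, add_mul, Algebra.TensorProduct.tmul_mul_tmul, one_mul,
        mul_one]
      rw [hmid]
      calc _ = ((gen q Gen.E * gen q Gen.F) ⊗ₜ[ℂ] gen q Gen.K -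
              (gen q Gen.F * gen q Gen.E) ⊗ₜ[ℂ] gen q Gen.K) +
            (gen q Gen.Kinv ⊗ₜ[ℂ] (gen q Gen.E * gen q Gen.F) -
              gen q Gen.Kinv ⊗ₜ[ℂ] (gen q Gen.F * gen q Gen.E)) := by abel
        _ = _ := by rw [h1, h2, ← smul_add]; congr 1; abel)

/-- The values of the counit on the generators. -/
def counitGen : Gen → ℂ
  | Gen.E => 0
  | Gen.F => 0
  | Gen.K => 1
  | Gen.Kinv => 1

/-- The counit of `U_q(sl₂)`, i.e. the one-dimensional trivial representation. -/
def counit (q : QParam) : Uq q →ₐ[ℂ] ℂ :=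
  liftHom q counitGen (by simp [counitGen]) (by simp [counitGen]) (by simp [counitGen])
    (by simp [counitGen]) (by simp [counitGen])

/-! ### The two-dimensional representation and its tensor powers -/

/-- The two-dimensional space `M₂`, with standard basis `e 0`, `e 1`. -/
abbrev M2 : Type := Fin 2 → ℂ

/-- The basis vectors of `M₂`. -/
def e (l : Fin 2) : M2 := Pi.single l 1

/-- The matrices of the generators in the basis `e 0`, `e 1` of `M₂`:
`K e₀ = q e₀`, `K e₁ = q⁻¹ e₁`, `F e₀ = e₁`, `F e₁ = 0`, `E e₀ = 0`, `E e₁ = e₀`. -/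
def matM2 (q : QParam) : Gen → Matrix (Fin 2) (Fin 2) ℂ
  | Gen.E => !![0, 1; 0, 0]
  | Gen.F => !![0, 0; 1, 0]
  | Gen.K => !![(q : ℂ), 0; 0, (q : ℂ)⁻¹]
  | Gen.Kinv => !![(q : ℂ)⁻¹, 0; 0, (q : ℂ)]

/-- The irreducible representation of `U_q(sl₂)` on `M₂`. -/
def repM2 (q : QParam) : Uq q →ₐ[ℂ] Module.End ℂ M2 :=
  (Matrix.toLinAlgEquiv' (R := ℂ) (n := Fin 2)).toAlgHom.comp <|
    liftHom q (matM2 q)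
      (by
        have := q.ne_zero
        ext i j; fin_cases i <;> fin_cases j <;> simp [matM2, this])
      (by
        have := q.ne_zero
        ext i j; fin_cases i <;> fin_cases j <;> simp [matM2, this])
      (by
        have := q.ne_zero
        ext i j; fin_cases i <;> fin_cases j <;> simp [matM2]
        field_simp)
      (by
        have := q.ne_zero
        ext i j; fin_cases i <;> fin_cases j <;> simp [matM2]
        field_simp)
      (by
        have := q.sub_inv_ne_zero
        have h' : (q : ℂ)⁻¹ - (q : ℂ) = -((q : ℂ) - (q : ℂ)⁻¹) := by ring
        ext i j; fin_cases i <;> fin_cases j <;> simp [matM2, this]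
        rw [h', mul_neg, inv_mul_cancel₀ this])

/-- The identification `M₂^{⊗ n} ⊗ M₂ ≃ M₂^{⊗ (n + 1)}`. -/
def snocEquiv (n : ℕ) : (⨂[ℂ]^n M2) ⊗[ℂ] M2 ≃ₗ[ℂ] ⨂[ℂ]^(n + 1) M2 :=
  (TensorProduct.congr (LinearEquiv.refl ℂ (⨂[ℂ]^n M2))
      (PiTensorProduct.subsingletonEquiv (R := ℂ) (s := fun _ : Fin 1 => M2) 0).symm).trans
    TensorPower.mulEquiv

theorem snocEquiv_tprod (n : ℕ) (x : Fin n → M2) (y : M2) :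
    snocEquiv n (PiTensorProduct.tprod ℂ x ⊗ₜ y) =
      PiTensorProduct.tprod ℂ (Fin.snoc (α := fun _ => M2) x y) := by
  have h1 : (PiTensorProduct.subsingletonEquiv (R := ℂ) (s := fun _ : Fin 1 => M2) 0).symm y =
      PiTensorProduct.tprod ℂ (fun _ : Fin 1 => y) := by
    rw [LinearEquiv.symm_apply_eq, PiTensorProduct.subsingletonEquiv_apply_tprod]
  have h2 : snocEquiv n (PiTensorProduct.tprod ℂ x ⊗ₜ y) =
      TensorPower.mulEquiv
        (PiTensorProduct.tprod ℂ x ⊗ₜ PiTensorProduct.tprod ℂ (fun _ : Fin 1 => y)) := by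
    rw [← h1]
    rfl
  rw [h2, ← TensorPower.gMul_def, TensorPower.tprod_mul_tprod, Fin.append_right_eq_snoc]

/-- The representation of `U_q(sl₂)` on `M₂^{⊗ n}`: trivial for `n = 0`, and obtained from the
coproduct on `M₂^{⊗ n} ⊗ M₂` for `n + 1`. -/
def rep (q : QParam) : (n : ℕ) → (Uq q →ₐ[ℂ] Module.End ℂ (⨂[ℂ]^n M2))
  | 0 => (Algebra.ofId ℂ (Module.End ℂ (⨂[ℂ]^0 M2))).comp (counit q)
  | n + 1 =>
    ((snocEquiv n).conjAlgEquiv ℂ).toAlgHom.comp <|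
      Module.endTensorEndAlgHom.comp <|
        (Algebra.TensorProduct.map (rep q n) (repM2 q)).comp (comul q)

/-! ### Projections to the singlet -/

/-- The singlet vector `s = (q - q⁻¹)⁻¹ (e₁ ⊗ e₀ - q e₀ ⊗ e₁)`. -/
def singlet (q : QParam) : M2 ⊗[ℂ] M2 :=
  ((q : ℂ) - (q : ℂ)⁻¹)⁻¹ • (e 1 ⊗ₜ e 0 - (q : ℂ) • (e 0 ⊗ₜ e 1))

/-- The basis `τ₀ = e₀ ⊗ e₀`, `τ₁ = q⁻¹ e₀ ⊗ e₁ + e₁ ⊗ e₀`, `τ₂ = [2] e₁ ⊗ e₁` of the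
triplet, where `[2] = q + q⁻¹`. -/
def triplet (q : QParam) : Fin 3 → M2 ⊗[ℂ] M2
  | 0 => e 0 ⊗ₜ e 0
  | 1 => (q : ℂ)⁻¹ • (e 0 ⊗ₜ e 1) + e 1 ⊗ₜ e 0
  | 2 => ((q : ℂ) + (q : ℂ)⁻¹) • (e 1 ⊗ₜ e 1)

/-- The projection `π̂ : M₂ ⊗ M₂ → ℂ` to the singlet, given on the tensor product basis; see
`eq_singletProj_iff` for its characterization by `π̂(s) = 1` and `π̂(τₗ) = 0`. -/
def singletProj (q : QParam) : M2 ⊗[ℂ] M2 →ₗ[ℂ] ℂ :=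
  TensorProduct.lift <|
    (((q : ℂ)⁻¹ - (q : ℂ)) / ((q : ℂ) + (q : ℂ)⁻¹)) •
        (LinearMap.mul ℂ ℂ).compl₁₂ (LinearMap.proj (0 : Fin 2)) (LinearMap.proj (1 : Fin 2)) +
      ((1 - ((q : ℂ) ^ 2)⁻¹) / ((q : ℂ) + (q : ℂ)⁻¹)) •
        (LinearMap.mul ℂ ℂ).compl₁₂ (LinearMap.proj (1 : Fin 2)) (LinearMap.proj (0 : Fin 2))

theorem singletProj_tmul (q : QParam) (x y : M2) :
    singletProj q (x ⊗ₜ y) =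
      ((q : ℂ)⁻¹ - (q : ℂ)) / ((q : ℂ) + (q : ℂ)⁻¹) * (x 0 * y 1) +
      (1 - ((q : ℂ) ^ 2)⁻¹) / ((q : ℂ) + (q : ℂ)⁻¹) * (x 1 * y 0) := by
  simp [singletProj]

theorem eq_singletProj_iff (q : QParam) (h2 : (q : ℂ) + (q : ℂ)⁻¹ ≠ 0)
    (f : M2 ⊗[ℂ] M2 →ₗ[ℂ] ℂ) :
    f = singletProj q ↔ f (singlet q) = 1 ∧ ∀ l, f (triplet q l) = 0 := by
  have h0 := q.ne_zero
  have h1 := q.sub_inv_ne_zero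
  have key : f = singletProj q ↔ ∀ i j : Fin 2, f (e i ⊗ₜ e j) = singletProj q (e i ⊗ₜ e j) := by
    constructor
    · rintro rfl i j
      rfl
    · intro h
      refine ((Pi.basisFun ℂ (Fin 2)).tensorProduct (Pi.basisFun ℂ (Fin 2))).ext ?_
      rintro ⟨i, j⟩
      simpa [Module.Basis.tensorProduct_apply, e] using h i j
  have s1 : (q : ℂ) ^ 2 - 1 ≠ 0 := sub_ne_zero.2 q.sq_ne_one
  have s2 : (q : ℂ) ^ 2 + 1 ≠ 0 := by
    intro h
    apply h2
    field_simp
    simpa using h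
  rw [key]
  constructor
  · intro h
    refine ⟨?_, fun l => ?_⟩
    · simp only [singlet, map_smul, map_sub, h, singletProj_tmul]
      simp [e]
      field_simp
      ring
    · fin_cases l <;> simp only [triplet, map_smul, map_add, h, singletProj_tmul] <;> simp [e]
      field_simp
      ring
  · rintro ⟨hs, ht⟩
    have t0 := ht 0
    have t1 := ht 1
    have t2 := ht 2
    simp only [singlet, triplet, map_smul, map_add, map_sub, smul_eq_mul] at hs t0 t1 t2
    have hs' : f (e 1 ⊗ₜ e 0) - q * f (e 0 ⊗ₜ e 1) = (q : ℂ) - (q : ℂ)⁻¹ := by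
      rwa [inv_mul_eq_iff_eq_mul₀ h1, mul_one] at hs
    have a01 : f (e 0 ⊗ₜ e 1) * ((q : ℂ) + (q : ℂ)⁻¹) = (q : ℂ)⁻¹ - q := by
      linear_combination t1 - hs'
    have a01' := eq_div_of_mul_eq h2 a01
    have a10 : f (e 1 ⊗ₜ e 0) = (1 - ((q : ℂ) ^ 2)⁻¹) / ((q : ℂ) + (q : ℂ)⁻¹) := by
      rw [eq_neg_of_add_eq_zero_right t1, a01']
      field_simp
      ring
    have a11 : f (e 1 ⊗ₜ e 1) = 0 := by simpa [h2] using t2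
    intro i j
    rw [singletProj_tmul]
    fin_cases i <;> fin_cases j <;> simp [e] <;>
      simp only [e] at t0 a01' a10 a11 <;> simp [t0, a01', a10, a11]

/-- The projection `π̂ⱼ = id^{⊗ (n + 1 - j)} ⊗ π̂ ⊗ id^{⊗ (j - 1)}` from `M₂^{⊗ (n + 2)}` to
`M₂^{⊗ n}`, acting on the tensor factors `j` and `j + 1` counted from the right, for
`1 ≤ j ≤ n + 1`; for other `j` it is set to zero. -/
def singletProjAt (q : QParam) : (n j : ℕ) → (⨂[ℂ]^(n + 2) M2 →ₗ[ℂ] ⨂[ℂ]^n M2)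
  | _, 0 => 0
  | n, 1 =>
    (TensorProduct.rid ℂ (⨂[ℂ]^n M2)).toLinearMap ∘ₗ
      (singletProj q).lTensor (⨂[ℂ]^n M2) ∘ₗ
      (TensorProduct.assoc ℂ (⨂[ℂ]^n M2) M2 M2).toLinearMap ∘ₗ
      ((snocEquiv n).symm.toLinearMap.rTensor M2) ∘ₗ
      (snocEquiv (n + 1)).symm.toLinearMap
  | 0, _ + 2 => 0
  | n + 1, j + 2 =>
    (snocEquiv n).toLinearMap ∘ₗ
      (singletProjAt q n (j + 1)).rTensor M2 ∘ₗ
      (snocEquiv (n + 2)).symm.toLinearMap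

/-! ### Link patterns -/

/-- A link pattern of `N` links: a planar pair partition of `{1, …, 2N}`. A link between `a` and
`b` with `a < b` is represented by the pair `(a, b)`. -/
@[ext]
structure LinkPattern (N : ℕ) where
  links : Finset (ℕ × ℕ)
  one_le : ∀ l ∈ links, 1 ≤ l.1
  lt : ∀ l ∈ links, l.1 < l.2
  le_two_mul : ∀ l ∈ links, l.2 ≤ 2 * N
  cover : ∀ i ∈ Finset.Icc 1 (2 * N), ∃! l, l ∈ links ∧ (l.1 = i ∨ l.2 = i)
  planar : ∀ l ∈ links, ∀ m ∈ links, l ≠ m →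
    0 < ((l.1 : ℤ) - m.1) * ((l.2 : ℤ) - m.2) * ((l.2 : ℤ) - m.1) * ((l.1 : ℤ) - m.2)

instance (N : ℕ) : Fintype (LinkPattern N) :=
  Fintype.ofInjective
    (fun α : LinkPattern N =>
      (⟨α.links, by
        rw [Finset.mem_powerset]
        intro l hl
        have h1 := α.one_le l hl
        have h2 := α.lt l hl
        have h3 := α.le_two_mul l hl
        simp only [Finset.mem_product, Finset.mem_Icc]
        omega⟩ : (Finset.Icc 1 (2 * N) ×ˢ Finset.Icc 1 (2 * N)).powerset))
    (by
      intro α β h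
      ext1
      simpa using h)

/-- The relabeling of indices after removal of the link between `j` and `j + 1`: indices greater
than `j + 1` are reduced by two. -/
def relabel (j i : ℕ) : ℕ := if j + 1 < i then i - 2 else i

theorem relabel_lt_iff {j a b : ℕ} (ha : a ≠ j) (ha' : a ≠ j + 1) (hb : b ≠ j) (hb' : b ≠ j + 1) :
    relabel j a < relabel j b ↔ a < b := by
  simp only [relabel]
  split_ifs <;> omega

theorem relabel_inj {j a b : ℕ} (ha : a ≠ j) (ha' : a ≠ j + 1) (hb : b ≠ j) (hb' : b ≠ j + 1)
    (h : relabel j a = relabel j b) : a = b := by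
  simp only [relabel] at h
  split_ifs at h <;> omega

theorem sign_relabel_sub {j a b : ℕ} (ha : a ≠ j) (ha' : a ≠ j + 1) (hb : b ≠ j)
    (hb' : b ≠ j + 1) :
    SignType.sign ((relabel j a : ℤ) - relabel j b) = SignType.sign ((a : ℤ) - b) := by
  have h1 := relabel_lt_iff ha ha' hb hb'
  have h2 := relabel_lt_iff hb hb' ha ha'
  rcases lt_trichotomy a b with h | rfl | h
  · rw [sign_neg (by omega), sign_neg (by omega)]
  · simp
  · rw [sign_pos (by omega), sign_pos (by omega)]

theorem LinkPattern.endpoint_ne {N : ℕ} (α : LinkPattern N) {j : ℕ} (hj : (j, j + 1) ∈ α.links)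
    {l : ℕ × ℕ} (hl : l ∈ α.links.erase (j, j + 1)) :
    l.1 ≠ j ∧ l.1 ≠ j + 1 ∧ l.2 ≠ j ∧ l.2 ≠ j + 1 := by
  obtain ⟨hne, hl⟩ := Finset.mem_erase.1 hl
  have hj1 := α.one_le _ hj
  have hj2 := α.le_two_mul _ hj
  simp only at hj1 hj2
  have c1 := (α.cover j (Finset.mem_Icc.2 ⟨hj1, by omega⟩)).unique (y₁ := l)
    (y₂ := (j, j + 1))
  have c2 := (α.cover (j + 1) (Finset.mem_Icc.2 ⟨by omega, hj2⟩)).unique (y₁ := l)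
    (y₂ := (j, j + 1))
  refine ⟨fun h => hne ?_, fun h => hne ?_, fun h => hne ?_, fun h => hne ?_⟩
  · exact c1 ⟨hl, Or.inl h⟩ ⟨hj, Or.inl rfl⟩
  · exact c2 ⟨hl, Or.inl h⟩ ⟨hj, Or.inr rfl⟩
  · exact c1 ⟨hl, Or.inr h⟩ ⟨hj, Or.inl rfl⟩
  · exact c2 ⟨hl, Or.inr h⟩ ⟨hj, Or.inr rfl⟩

/-- The link pattern of `N` links obtained from a link pattern of `N + 1` links by removing the
link between `j` and `j + 1` and relabeling the remaining indices by `1, …, 2N`. -/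
def LinkPattern.remove {N : ℕ} (α : LinkPattern (N + 1)) (j : ℕ) (hj : (j, j + 1) ∈ α.links) :
    LinkPattern N where
  links := (α.links.erase (j, j + 1)).image (Prod.map (relabel j) (relabel j))
  one_le := by
    intro m hm
    obtain ⟨l, hl, rfl⟩ := Finset.mem_image.1 hm
    have h1 := α.one_le l (Finset.mem_of_mem_erase hl)
    have h2 := α.one_le _ hj
    simp only [Prod.map_fst, relabel]
    split_ifs <;> omega
  lt := by
    intro m hm
    obtain ⟨l, hl, rfl⟩ := Finset.mem_image.1 hm
    obtain ⟨h1, h2, h3, h4⟩ := α.endpoint_ne hj hl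
    have h5 := α.lt l (Finset.mem_of_mem_erase hl)
    simpa only [Prod.map_fst, Prod.map_snd] using (relabel_lt_iff h1 h2 h3 h4).2 h5
  le_two_mul := by
    intro m hm
    obtain ⟨l, hl, rfl⟩ := Finset.mem_image.1 hm
    obtain ⟨h1, h2, h3, h4⟩ := α.endpoint_ne hj hl
    have h5 := α.le_two_mul l (Finset.mem_of_mem_erase hl)
    have h6 := α.le_two_mul _ hj
    simp only [Prod.map_snd, relabel]
    simp only at h6
    split_ifs <;> omega
  cover := by
    intro i hi
    rw [Finset.mem_Icc] at hi
    obtain ⟨i', hi', hne, hne', hr⟩ : ∃ i' ∈ Finset.Icc 1 (2 * (N + 1)),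
        i' ≠ j ∧ i' ≠ j + 1 ∧ relabel j i' = i := by
      by_cases h : i < j
      · exact ⟨i, Finset.mem_Icc.2 ⟨by omega, by omega⟩, by omega, by omega,
          by simp only [relabel]; split_ifs <;> omega⟩
      · exact ⟨i + 2, Finset.mem_Icc.2 ⟨by omega, by omega⟩, by omega, by omega,
          by simp only [relabel]; split_ifs <;> omega⟩
    obtain ⟨l, ⟨hl, hli⟩, huniq⟩ := α.cover i' hi'
    have hl' : l ∈ α.links.erase (j, j + 1) := by
      refine Finset.mem_erase.2 ⟨?_, hl⟩
      rintro rfl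
      rcases hli with h | h <;> simp only at h <;> omega
    refine ⟨Prod.map (relabel j) (relabel j) l, ⟨Finset.mem_image_of_mem _ hl', ?_⟩, ?_⟩
    · rcases hli with h | h
      · exact Or.inl (by simp [h, hr])
      · exact Or.inr (by simp [h, hr])
    · rintro m ⟨hm, hmi⟩
      obtain ⟨k, hk, rfl⟩ := Finset.mem_image.1 hm
      obtain ⟨h1, h2, h3, h4⟩ := α.endpoint_ne hj hk
      rw [huniq k ⟨Finset.mem_of_mem_erase hk, ?_⟩]
      simp only [Prod.map_fst, Prod.map_snd, ← hr] at hmi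
      exact hmi.imp (relabel_inj h1 h2 hne hne') (relabel_inj h3 h4 hne hne')
  planar := by
    intro l' hl' m' hm' hne
    obtain ⟨l, hl, rfl⟩ := Finset.mem_image.1 hl'
    obtain ⟨m, hm, rfl⟩ := Finset.mem_image.1 hm'
    obtain ⟨h1, h2, h3, h4⟩ := α.endpoint_ne hj hl
    obtain ⟨k1, k2, k3, k4⟩ := α.endpoint_ne hj hm
    have h := α.planar l (Finset.mem_of_mem_erase hl) m (Finset.mem_of_mem_erase hm)
      (by rintro rfl; exact hne rfl)
    rw [← sign_eq_one_iff] at h ⊢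
    simp only [sign_mul, Prod.map_fst, Prod.map_snd] at h ⊢
    rw [sign_relabel_sub h1 h2 k1 k2, sign_relabel_sub h3 h4 k3 k4,
      sign_relabel_sub h3 h4 k1 k2, sign_relabel_sub h1 h2 k3 k4]
    exact h

/-! ### The systems of equations -/

/-- The normalization `1 ∈ ℂ = M₂^{⊗ 0}`. -/
def one0 : ⨂[ℂ]^0 M2 := (PiTensorProduct.isEmptyEquiv (Fin 0)).symm (1 : ℂ)

/-- The system of equations for the family `(v_α)` indexed by all link patterns. -/
structure IsPureFamily (q : QParam) (v : (N : ℕ) → LinkPattern N → ⨂[ℂ]^(2 * N) M2) : Prop where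
  normalization : ∀ α : LinkPattern 0, v 0 α = one0
  cartan : ∀ N (α : LinkPattern N), rep q (2 * N) (gen q Gen.K) (v N α) = v N α
  highest : ∀ N (α : LinkPattern N), rep q (2 * N) (gen q Gen.E) (v N α) = 0
  proj_of_notMem : ∀ N (α : LinkPattern (N + 1)), ∀ j ∈ Finset.Icc 1 (2 * N + 1),
    (j, j + 1) ∉ α.links → singletProjAt q (2 * N) j (v (N + 1) α) = 0
  proj_of_mem : ∀ N (α : LinkPattern (N + 1)), ∀ j ∈ Finset.Icc 1 (2 * N + 1),
    ∀ hj : (j, j + 1) ∈ α.links,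
      singletProjAt q (2 * N) j (v (N + 1) α) = v N (α.remove j hj)

/-- The system of equations for the family `(v^{(N)})`. -/
structure IsSymmetricFamily (q : QParam) (v : (N : ℕ) → ⨂[ℂ]^(2 * N) M2) : Prop where
  normalization : v 0 = one0
  cartan : ∀ N, 0 < N → rep q (2 * N) (gen q Gen.K) (v N) = v N
  highest : ∀ N, 0 < N → rep q (2 * N) (gen q Gen.E) (v N) = 0
  proj : ∀ N, ∀ j ∈ Finset.Icc 1 (2 * N + 1),
    singletProjAt q (2 * N) j (v (N + 1)) = v N

end QSL2

end

noncomputable section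

namespace QSL2

/-! ### Slices of tensors -/

/-! Write H_N for the space of vectors x of `M₂^{⊗ 2N}` with K x = x and E x = 0 (`singletSpace`).
Each projection commutes with the actions of K and E, so it maps H_{N+1} to H_N.

Uniqueness, for both systems, rests on one fact: for N > 0, a vector of H_N annihilated by all
projections is zero (`eq_zero_of_singletProjAt_eq_zero`). Being annihilated is a q-symmetry
condition on adjacent factors. In a fixed weight it forces E to act, up to an explicit geometric sum
in q^2, as the deletion of an e₁. That sum is nonzero because q is not a root of unity, so E x = 0
kills x unless every factor is e₀. The difference of two solutions is then zero by induction on N.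

For existence, projecting successively along short links of α ends in ℂ and defines a functional
ℓ_α. The order of projection does not matter, since projections at disjoint places commute
(`linkFunctional_succ`). By the fact above, the ℓ_α separate the points of H_N, so dim H_N is at
most the number of link patterns. Rank–nullity for E on the weight space gives dim H_N ≥ C(2N, N) -
C(2N, N+1), the Catalan number, and an injection into Dyck words bounds the number of link patterns
by the same number. Hence the ℓ_α form a basis of the dual of H_N (`linkEval_bijective`), and the
v_α are the dual basis.

Finally, π̂ⱼ(∑ v_α) is the sum of v_{α/{j,j+1}} over the α containing {j, j+1}. Removal of that link
is a bijection from these α to all link patterns with one link fewer, so the sum is the preceding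
vector (`LinkPattern.sum_remove`). -/

/-- The coefficient of `e a` in the last (rightmost) tensor factor. -/
def slice (n : ℕ) (a : Fin 2) : ⨂[ℂ]^(n + 1) M2 →ₗ[ℂ] ⨂[ℂ]^n M2 :=
  (TensorProduct.rid ℂ (⨂[ℂ]^n M2)).toLinearMap ∘ₗ
    (LinearMap.proj a : M2 →ₗ[ℂ] ℂ).lTensor (⨂[ℂ]^n M2) ∘ₗ (snocEquiv n).symm.toLinearMap

@[simp]
theorem slice_snocEquiv_tmul (n : ℕ) (a : Fin 2) (y : ⨂[ℂ]^n M2) (m : M2) :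
    slice n a (snocEquiv n (y ⊗ₜ m)) = m a • y := by
  simp [slice]

theorem snoc_induction {n : ℕ} {p : ⨂[ℂ]^(n + 1) M2 → Prop}
    (tmul : ∀ (y : ⨂[ℂ]^n M2) (m : M2), p (snocEquiv n (y ⊗ₜ m)))
    (add : ∀ x y, p x → p y → p (x + y)) (x : ⨂[ℂ]^(n + 1) M2) : p x := by
  obtain ⟨t, rfl⟩ := (snocEquiv n).surjective x
  induction t with
  | zero => simpa using tmul 0 0
  | tmul y m => exact tmul y m
  | add s t hs ht => rw [map_add]; exact add _ _ hs ht

theorem snoc_slice (n : ℕ) (x : ⨂[ℂ]^(n + 1) M2) :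
    snocEquiv n (slice n 0 x ⊗ₜ e 0) + snocEquiv n (slice n 1 x ⊗ₜ e 1) = x := by
  induction x using snoc_induction with
  | tmul y m =>
    rw [slice_snocEquiv_tmul, slice_snocEquiv_tmul, TensorProduct.smul_tmul,
      TensorProduct.smul_tmul, ← map_add, ← TensorProduct.tmul_add]
    congr 2
    ext i
    fin_cases i <;> simp [e]
  | add x y hx hy =>
    rw [map_add, map_add, TensorProduct.add_tmul, TensorProduct.add_tmul, map_add, map_add]
    nth_rewrite 3 [← hx]
    nth_rewrite 3 [← hy]
    abel

theorem ext_slice {n : ℕ} {x y : ⨂[ℂ]^(n + 1) M2} (h0 : slice n 0 x = slice n 0 y)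
    (h1 : slice n 1 x = slice n 1 y) : x = y := by
  rw [← snoc_slice n x, h0, h1, snoc_slice]

/-- The identification of `M₂^{⊗ (n + 1)}` with pairs of slices. -/
def sliceEquiv (n : ℕ) : (⨂[ℂ]^(n + 1) M2) ≃ₗ[ℂ] (⨂[ℂ]^n M2) × (⨂[ℂ]^n M2) :=
  LinearEquiv.ofBijective ((slice n 0).prod (slice n 1)) ⟨fun x y h => by
    exact ext_slice (congrArg Prod.fst h) (congrArg Prod.snd h), fun p => by
    refine ⟨snocEquiv n (p.1 ⊗ₜ e 0) + snocEquiv n (p.2 ⊗ₜ e 1), ?_⟩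
    ext1 <;> simp [e]⟩

@[simp]
theorem sliceEquiv_apply (n : ℕ) (x : ⨂[ℂ]^(n + 1) M2) :
    sliceEquiv n x = (slice n 0 x, slice n 1 x) := rfl

section action

variable (q : QParam)

theorem rep_zero (u : Uq q) (x : ⨂[ℂ]^0 M2) : rep q 0 u x = counit q u • x := by
  simp [rep, Algebra.ofId_apply, Module.algebraMap_end_apply]

theorem rep_zero_K (x : ⨂[ℂ]^0 M2) : rep q 0 (gen q Gen.K) x = x := by
  rw [rep_zero, counit, liftHom_gen]; simp [counitGen]

theorem rep_zero_E (x : ⨂[ℂ]^0 M2) : rep q 0 (gen q Gen.E) x = 0 := by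
  rw [rep_zero, counit, liftHom_gen]; simp [counitGen]

theorem repM2_gen (g : Gen) : repM2 q (gen q g) = Matrix.toLinAlgEquiv' (matM2 q g) := by
  simp [repM2, liftHom_gen]

theorem rep_succ_K (n : ℕ) (y : ⨂[ℂ]^n M2) (m : M2) :
    rep q (n + 1) (gen q Gen.K) (snocEquiv n (y ⊗ₜ m)) =
      snocEquiv n (rep q n (gen q Gen.K) y ⊗ₜ repM2 q (gen q Gen.K) m) := by
  simp [rep, comul, liftHom_gen, comulGen, Module.endTensorEndAlgHom_apply]

theorem rep_succ_E (n : ℕ) (y : ⨂[ℂ]^n M2) (m : M2) :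
    rep q (n + 1) (gen q Gen.E) (snocEquiv n (y ⊗ₜ m)) =
      snocEquiv n (rep q n (gen q Gen.E) y ⊗ₜ repM2 q (gen q Gen.K) m) +
      snocEquiv n (y ⊗ₜ repM2 q (gen q Gen.E) m) := by
  simp [rep, comul, liftHom_gen, comulGen, Module.endTensorEndAlgHom_apply]

@[simp]
theorem slice_zero_K (n : ℕ) (x : ⨂[ℂ]^(n + 1) M2) :
    slice n 0 (rep q (n + 1) (gen q Gen.K) x) =
      (q : ℂ) • rep q n (gen q Gen.K) (slice n 0 x) := by
  induction x using snoc_induction with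
  | tmul y m => simp [rep_succ_K, repM2_gen, matM2, Matrix.toLinAlgEquiv'_apply, mul_smul,
      Matrix.vecHead, Matrix.vecTail]
  | add x y hx hy => simp only [map_add, hx, hy, smul_add]

@[simp]
theorem slice_one_K (n : ℕ) (x : ⨂[ℂ]^(n + 1) M2) :
    slice n 1 (rep q (n + 1) (gen q Gen.K) x) =
      (q : ℂ)⁻¹ • rep q n (gen q Gen.K) (slice n 1 x) := by
  induction x using snoc_induction with
  | tmul y m => simp [rep_succ_K, repM2_gen, matM2, Matrix.toLinAlgEquiv'_apply, mul_smul,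
      Matrix.vecHead, Matrix.vecTail]
  | add x y hx hy => simp only [map_add, hx, hy, smul_add]

-- In `Δ(E) = E ⊗ K + 1 ⊗ E`, the factor K contributes the scalar q on e₀, and `1 ⊗ E` turns a last
-- factor e₁ into e₀.
@[simp]
theorem slice_zero_E (n : ℕ) (x : ⨂[ℂ]^(n + 1) M2) :
    slice n 0 (rep q (n + 1) (gen q Gen.E) x) =
      (q : ℂ) • rep q n (gen q Gen.E) (slice n 0 x) + slice n 1 x := by
  induction x using snoc_induction with
  | tmul y m => simp [rep_succ_E, repM2_gen, matM2, Matrix.toLinAlgEquiv'_apply, mul_smul,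
      Matrix.vecHead, Matrix.vecTail]
  | add x y hx hy => simp only [map_add, hx, hy, smul_add]; abel

@[simp]
theorem slice_one_E (n : ℕ) (x : ⨂[ℂ]^(n + 1) M2) :
    slice n 1 (rep q (n + 1) (gen q Gen.E) x) =
      (q : ℂ)⁻¹ • rep q n (gen q Gen.E) (slice n 1 x) := by
  induction x using snoc_induction with
  | tmul y m => simp [rep_succ_E, repM2_gen, matM2, Matrix.toLinAlgEquiv'_apply, mul_smul,
      Matrix.vecHead, Matrix.vecTail]
  | add x y hx hy => simp only [map_add, hx, hy, smul_add]

@[simp]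
theorem singletProjAt_zero_right (n : ℕ) : singletProjAt q n 0 = 0 := by
  cases n <;> rfl

theorem singletProjAt_one (n : ℕ) (x : ⨂[ℂ]^(n + 2) M2) :
    singletProjAt q n 1 x =
      (((q : ℂ)⁻¹ - (q : ℂ)) / ((q : ℂ) + (q : ℂ)⁻¹)) • slice n 0 (slice (n + 1) 1 x) +
      ((1 - ((q : ℂ) ^ 2)⁻¹) / ((q : ℂ) + (q : ℂ)⁻¹)) • slice n 1 (slice (n + 1) 0 x) := by
  induction x using snoc_induction with
  | tmul y m =>
    induction y using snoc_induction with
    | tmul z l =>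
      simp [singletProjAt, singletProj_tmul, add_smul, smul_smul, mul_comm]
    | add x y hx hy =>
      rw [TensorProduct.add_tmul, map_add, map_add, hx, hy]
      simp only [map_add, smul_add]
      abel
  | add x y hx hy => simp only [map_add, hx, hy, smul_add]; abel

-- Projections at position 2 or higher do not touch the last factor. Together with
-- `singletProjAt_one` this reduces statements on projections to inductions on the number of
-- factors.
@[simp]
theorem slice_singletProjAt (n j : ℕ) (a : Fin 2) (x : ⨂[ℂ]^(n + 3) M2) :
    slice n a (singletProjAt q (n + 1) (j + 2) x) =
      singletProjAt q n (j + 1) (slice (n + 2) a x) := by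
  induction x using snoc_induction with
  | tmul y m => simp [singletProjAt]
  | add x y hx hy => simp only [map_add, hx, hy]

end action

/-! ### Projections commute with the action and with each other -/

section commute

variable (q : QParam)

theorem singletProjAt_K (n j : ℕ) (x : ⨂[ℂ]^(n + 2) M2) :
    singletProjAt q n j (rep q (n + 2) (gen q Gen.K) x) =
      rep q n (gen q Gen.K) (singletProjAt q n j x) := by
  have hq := q.ne_zero
  induction n generalizing j with
  | zero =>
    match j with
    | 0 => simp
    | 1 => simp [singletProjAt_one, hq]
    | _ + 2 => simp [singletProjAt]
  | succ n ih =>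
    match j with
    | 0 => simp
    | 1 => simp [singletProjAt_one, hq]
    | j + 2 => exact ext_slice (by simp [ih]) (by simp [ih])

theorem singletProjAt_one_E (n : ℕ) (x : ⨂[ℂ]^(n + 2) M2) :
    singletProjAt q n 1 (rep q (n + 2) (gen q Gen.E) x) =
      rep q n (gen q Gen.E) (singletProjAt q n 1 x) := by
  have hq := q.ne_zero
  -- With this relation the coefficients of e₁ ⊗ e₁ cancel: E maps that vector into the triplet,
  -- which `π̂` annihilates.
  have h : ((q : ℂ)⁻¹ - (q : ℂ)) / ((q : ℂ) + (q : ℂ)⁻¹) * (q : ℂ)⁻¹ =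
      -((1 - ((q : ℂ) ^ 2)⁻¹) / ((q : ℂ) + (q : ℂ)⁻¹)) := by
    rw [div_mul_eq_mul_div, ← neg_div]
    congr 1
    field_simp
    ring
  simp only [singletProjAt_one, slice_one_E, slice_zero_E, map_smul, map_add, smul_add, smul_smul,
    h, inv_mul_cancel₀ hq, mul_inv_cancel₀ hq, mul_one]
  module

theorem singletProjAt_E (n j : ℕ) (x : ⨂[ℂ]^(n + 2) M2) :
    singletProjAt q n j (rep q (n + 2) (gen q Gen.E) x) =
      rep q n (gen q Gen.E) (singletProjAt q n j x) := by
  induction n generalizing j with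
  | zero =>
    match j with
    | 0 => simp
    | 1 => exact singletProjAt_one_E q 0 x
    | _ + 2 => simp [singletProjAt]
  | succ n ih =>
    match j with
    | 0 => simp
    | 1 => exact singletProjAt_one_E q _ x
    | j + 2 => exact ext_slice (by simp [ih]) (by simp [ih])

/-- The two projections act on disjoint pairs of factors. Contracting the pair further to the right
first lowers the position of the other from i + k + 3 to i + k + 1. -/
theorem singletProjAt_comm (n i k : ℕ) (x : ⨂[ℂ]^(n + 4) M2) (h : i + k ≤ n) :
    singletProjAt q n (i + k + 1) (singletProjAt q (n + 2) (i + 1) x) =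
      singletProjAt q n (i + 1) (singletProjAt q (n + 2) (i + k + 3) x) := by
  induction i generalizing n with
  | zero => simp [singletProjAt_one]
  | succ i ih =>
    obtain ⟨n, rfl⟩ : ∃ m, n = m + 1 := ⟨n - 1, by omega⟩
    have h1 : i + 1 + k = (i + k) + 1 := by ring
    rw [h1]
    have s1 : ∀ a l, slice (n + 2) a (singletProjAt q (n + 1 + 2) (l + 2) x) =
        singletProjAt q (n + 2) (l + 1) (slice (n + 4) a x) :=
      fun a l => slice_singletProjAt q (n + 2) l a x
    have s2 : ∀ a, slice n a (singletProjAt q (n + 1) (i + k + 2)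
        (singletProjAt q (n + 1 + 2) (i + 2) x)) = slice n a (singletProjAt q (n + 1) (i + 2)
          (singletProjAt q (n + 1 + 2) (i + k + 2 + 2) x)) := fun a =>
      (slice_singletProjAt q n (i + k) a _).trans <| (congrArg _ (s1 a i)).trans <|
        (ih n _ (by omega)).trans
          ((slice_singletProjAt q n i a _).trans (congrArg _ (s1 a (i + k + 2)))).symm
    exact ext_slice (s2 0) (s2 1)

end commute

/-! ### Weight spaces -/

theorem free_submodule_complex {V : Type*} [AddCommGroup V] [Module ℂ V] (p : Submodule ℂ V) :
    Module.Free ℂ p := inferInstance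

/-- Rank–nullity for `f` restricted to a map from `A` to `B`. Surjectivity onto `B` is not needed
for a lower bound on the kernel. -/
theorem finrank_le_add_finrank_inf_ker {V : Type*} [AddCommGroup V] [Module ℂ V]
    [FiniteDimensional ℂ V] (A B : Submodule ℂ V) (f : V →ₗ[ℂ] V) (h : ∀ x ∈ A, f x ∈ B) :
    Module.finrank ℂ A ≤
      Module.finrank ℂ B + Module.finrank ℂ (A ⊓ LinearMap.ker f : Submodule ℂ V) := by
  have h1 := (f.restrict h).finrank_range_add_finrank_ker
  have h2 := Submodule.finrank_le (LinearMap.range (f.restrict h))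
  have h3 : Module.finrank ℂ (LinearMap.ker (f.restrict h)) ≤
      Module.finrank ℂ (A ⊓ LinearMap.ker f : Submodule ℂ V) := by
    refine LinearMap.finrank_le_finrank_of_injective
      (f := (A.subtype ∘ₗ (LinearMap.ker (f.restrict h)).subtype).codRestrict _ ?_) ?_
    · rintro ⟨x, hx⟩
      exact ⟨x.2, congrArg Subtype.val hx⟩
    · intro x y hxy
      have hxy := congrArg Subtype.val hxy
      exact Subtype.ext (Subtype.ext hxy)
  omega

/-- The weight space of `M₂^{⊗ n}` spanned by the basis vectors with `d` factors `e 0`. -/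
def weightSpace (q : QParam) (n : ℕ) (d : ℤ) : Submodule ℂ (⨂[ℂ]^n M2) :=
  LinearMap.ker (rep q n (gen q Gen.K) - (q : ℂ) ^ (2 * d - n) • LinearMap.id)

section weight

variable {q : QParam}

theorem mem_weightSpace {n : ℕ} {d : ℤ} {x : ⨂[ℂ]^n M2} :
    x ∈ weightSpace q n d ↔ rep q n (gen q Gen.K) x = (q : ℂ) ^ (2 * d - n) • x := by
  simp [weightSpace, sub_eq_zero]

/-- A last factor e₀ accounts for one of the d factors e₀; a last factor e₁ for none. -/
theorem mem_weightSpace_succ {n : ℕ} {d : ℤ} {x : ⨂[ℂ]^(n + 1) M2} :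
    x ∈ weightSpace q (n + 1) d ↔
      slice n 0 x ∈ weightSpace q n (d - 1) ∧ slice n 1 x ∈ weightSpace q n d := by
  have hq := q.ne_zero
  have e0 : (q : ℂ) ^ (2 * d - (n + 1 : ℕ)) = (q : ℂ) * (q : ℂ) ^ (2 * (d - 1) - n) := by
    rw [← zpow_one_add₀ hq]; congr 1; push_cast; ring
  have e1 : (q : ℂ) ^ (2 * d - (n + 1 : ℕ)) = (q : ℂ)⁻¹ * (q : ℂ) ^ (2 * d - n) := by
    rw [← zpow_neg_one, ← zpow_add₀ hq]; congr 1; push_cast; ring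
  rw [mem_weightSpace, mem_weightSpace, mem_weightSpace]
  have key : ∀ {c : ℂ} (_ : c ≠ 0) (y z : ⨂[ℂ]^n M2), c • y = c • z ↔ y = z :=
    fun hc y z => (smul_right_injective _ hc).eq_iff
  rw [← key hq (rep q n (gen q Gen.K) (slice n 0 x)),
    ← key (inv_ne_zero hq) (rep q n (gen q Gen.K) (slice n 1 x)), ← slice_zero_K, ← slice_one_K,
    smul_smul, smul_smul, ← e0, ← e1, ← map_smul, ← map_smul]
  exact ⟨fun h => by rw [h]; exact ⟨rfl, rfl⟩, fun h => ext_slice h.1 h.2⟩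

/-- A weight space of `M₂^{⊗ (n + 1)}` decomposes into slices. -/
def weightSpaceSuccEquiv (n : ℕ) (d : ℤ) :
    weightSpace q (n + 1) d ≃ₗ[ℂ] weightSpace q n (d - 1) × weightSpace q n d where
  toFun x := (⟨slice n 0 x, (mem_weightSpace_succ.1 x.2).1⟩,
    ⟨slice n 1 x, (mem_weightSpace_succ.1 x.2).2⟩)
  map_add' x y := by ext <;> simp
  map_smul' c x := by ext <;> simp
  invFun p := ⟨(sliceEquiv n).symm (p.1, p.2), by
    have h := (sliceEquiv n).apply_symm_apply ((p.1 : ⨂[ℂ]^n M2), (p.2 : ⨂[ℂ]^n M2))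
    rw [sliceEquiv_apply, Prod.mk.injEq] at h
    rw [mem_weightSpace_succ, h.1, h.2]
    exact ⟨p.1.2, p.2.2⟩⟩
  left_inv x := by
    ext1
    exact (sliceEquiv n).symm_apply_apply x
  right_inv p := by
    have h := (sliceEquiv n).apply_symm_apply ((p.1 : ⨂[ℂ]^n M2), (p.2 : ⨂[ℂ]^n M2))
    rw [sliceEquiv_apply, Prod.mk.injEq] at h
    ext1
    · exact Subtype.ext h.1
    · exact Subtype.ext h.2

theorem zpow_ne_one_of_not_root (hq : ∀ n : ℕ, n ≠ 0 → (q : ℂ) ^ n ≠ 1)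
    {n : ℤ} (hn : n ≠ 0) : (q : ℂ) ^ n ≠ 1 := by
  obtain ⟨m, rfl | rfl⟩ := n.eq_nat_or_neg
  · rw [zpow_natCast]; exact hq m (by omega)
  · rw [zpow_neg, zpow_natCast, Ne, inv_eq_one]; exact hq m (by omega)

/-- Slicing keeps d out of range down to zero factors, where K acts as the identity while q^(2d) ≠
1. -/
theorem weightSpace_eq_bot (hq : ∀ n : ℕ, n ≠ 0 → (q : ℂ) ^ n ≠ 1)
    {n : ℕ} {d : ℤ} (h : d < 0 ∨ n < d) : weightSpace q n d = ⊥ := by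
  rw [eq_bot_iff]
  intro x hx
  rw [Submodule.mem_bot]
  induction n generalizing d with
  | zero =>
    rw [mem_weightSpace, rep_zero_K] at hx
    have h1 : (1 - (q : ℂ) ^ (2 * d - (0 : ℕ))) • x = 0 := by
      exact (sub_smul _ _ x).trans (by rw [one_smul, ← hx, sub_self])
    refine (smul_eq_zero.1 h1).resolve_left (sub_ne_zero.2 (Ne.symm ?_))
    exact zpow_ne_one_of_not_root hq (by push_cast at h ⊢; omega)
  | succ n ih =>
    rw [mem_weightSpace_succ] at hx
    refine ext_slice ?_ ?_
    · rw [map_zero]; exact ih (by push_cast at h; omega) hx.1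
    · rw [map_zero]; exact ih (by push_cast at h; omega) hx.2

instance (n : ℕ) (p : Submodule ℂ (⨂[ℂ]^n M2)) : Module.Free ℂ p :=
  free_submodule_complex p

/-- The decomposition into slices is Pascal's rule. -/
theorem finrank_weightSpace (hq : ∀ n : ℕ, n ≠ 0 → (q : ℂ) ^ n ≠ 1)
    (n d : ℕ) :
    Module.finrank ℂ (weightSpace q n d) = n.choose d := by
  induction n generalizing d with
  | zero =>
    cases d with
    | zero =>
      have : weightSpace q 0 (0 : ℕ) = ⊤ := by
        rw [eq_top_iff]; intro x _; simp [mem_weightSpace, rep_zero_K]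
      rw [this, finrank_top, (PiTensorProduct.isEmptyEquiv (Fin 0)).finrank_eq]
      simp
    | succ d =>
      rw [weightSpace_eq_bot hq (Or.inr (by push_cast; omega))]
      simp
  | succ n ih =>
    rw [(weightSpaceSuccEquiv n d).finrank_eq, Module.finrank_prod, ih d]
    cases d with
    | zero => rw [weightSpace_eq_bot hq (Or.inl (by simp))]; simp
    | succ d =>
      rw [Nat.choose_succ_succ, ← ih d, Nat.cast_add, Nat.cast_one, add_sub_cancel_right]

theorem E_mem_weightSpace {n : ℕ} {d : ℤ} {x : ⨂[ℂ]^n M2} (hx : x ∈ weightSpace q n d) :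
    rep q n (gen q Gen.E) x ∈ weightSpace q n (d + 1) := by
  rw [mem_weightSpace] at hx ⊢
  rw [← Module.End.mul_apply, ← map_mul, K_mul_E, map_smul, map_mul, LinearMap.smul_apply,
    Module.End.mul_apply, hx, map_smul, smul_smul, ← zpow_natCast, ← zpow_add₀ q.ne_zero]
  congr 2
  push_cast
  ring

end weight

/-- The highest weight vectors of weight zero in `M₂^{⊗ 2N}`. -/
def singletSpace (q : QParam) (N : ℕ) : Submodule ℂ (⨂[ℂ]^(2 * N) M2) :=
  weightSpace q (2 * N) N ⊓ LinearMap.ker (rep q (2 * N) (gen q Gen.E))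

theorem mem_singletSpace {q : QParam} {N : ℕ} {x : ⨂[ℂ]^(2 * N) M2} :
    x ∈ singletSpace q N ↔
      rep q (2 * N) (gen q Gen.K) x = x ∧ rep q (2 * N) (gen q Gen.E) x = 0 := by
  simp [singletSpace, mem_weightSpace]

theorem singletProjAt_mem_singletSpace {q : QParam} {N : ℕ} (j : ℕ) {x : ⨂[ℂ]^(2 * (N + 1)) M2}
    (hx : x ∈ singletSpace q (N + 1)) : singletProjAt q (2 * N) j x ∈ singletSpace q N := by
  rw [mem_singletSpace] at hx ⊢
  have h1 := singletProjAt_K q (2 * N) j x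
  have h2 := singletProjAt_E q (2 * N) j x
  exact ⟨h1.symm.trans (congrArg _ hx.1), h2.symm.trans ((congrArg _ hx.2).trans (map_zero _))⟩

/-- Multiply by N + 1 and use (N + 1) C(2N, N+1) = N C(2N, N). The additive form avoids truncated
subtraction. -/
theorem catalan_add_choose (N : ℕ) : catalan N + (2 * N).choose (N + 1) = (2 * N).choose N := by
  have h1 := succ_mul_catalan_eq_centralBinom N
  have h2 := Nat.choose_succ_right_eq (2 * N) N
  rw [Nat.centralBinom_eq_two_mul_choose] at h1
  have h3 : 2 * N - N = N := by omega
  rw [h3] at h2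
  have : (N + 1) * (catalan N + (2 * N).choose (N + 1)) = (N + 1) * (2 * N).choose N := by
    linarith
  exact Nat.eq_of_mul_eq_mul_left (Nat.succ_pos N) this

/-- E raises d by one, so it maps a space of dimension C(2N, N) to one of dimension C(2N, N+1). -/
theorem catalan_le_finrank_singletSpace {q : QParam} (hq : ∀ n : ℕ, n ≠ 0 → (q : ℂ) ^ n ≠ 1)
    (N : ℕ) : catalan N ≤ Module.finrank ℂ (singletSpace q N) := by
  have h := finrank_le_add_finrank_inf_ker (weightSpace q (2 * N) N)
    (weightSpace q (2 * N) (N + 1 : ℕ)) (rep q (2 * N) (gen q Gen.E)) fun x hx => by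
      rw [Nat.cast_add, Nat.cast_one]
      exact E_mem_weightSpace hx
  rw [finrank_weightSpace hq, finrank_weightSpace hq, ← catalan_add_choose N, add_comm] at h
  exact Nat.le_of_add_le_add_left h

/-! ### Vectors annihilated by all projections -/

/-- The vectors of `M₂^{⊗ n}` annihilated by all projections to the singlet. -/
def projKernel (q : QParam) : (n : ℕ) → Submodule ℂ (⨂[ℂ]^n M2)
  | 0 => ⊤
  | 1 => ⊤
  | n + 2 => ⨅ j ∈ Finset.Icc 1 (n + 1), LinearMap.ker (singletProjAt q n j)

section kernel

variable {q : QParam}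

theorem mem_projKernel {n : ℕ} {x : ⨂[ℂ]^(n + 2) M2} :
    x ∈ projKernel q (n + 2) ↔ ∀ j ∈ Finset.Icc 1 (n + 1), singletProjAt q n j x = 0 := by
  simp [projKernel]

theorem slice_mem_projKernel {n : ℕ} {x : ⨂[ℂ]^(n + 1) M2} (hx : x ∈ projKernel q (n + 1))
    (a : Fin 2) : slice n a x ∈ projKernel q n := by
  match n with
  | 0 => trivial
  | 1 => trivial
  | n + 2 =>
    have hx := mem_projKernel (n := n + 1).1 hx
    rw [mem_projKernel]
    intro j hj
    rw [Finset.mem_Icc] at hj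
    obtain ⟨i, rfl⟩ : ∃ i, j = i + 1 := ⟨j - 1, by omega⟩
    rw [← slice_singletProjAt, hx (i + 2) (Finset.mem_Icc.2 ⟨by omega, by omega⟩), map_zero]

/-- The equation for the last two factors, divided by a coefficient that is nonzero because q is not
a root of unity: exchanging adjacent e₀ and e₁ costs a factor q. -/
theorem slice_one_zero_of_mem_projKernel (hq : ∀ n : ℕ, n ≠ 0 → (q : ℂ) ^ n ≠ 1)
    {n : ℕ} {x : ⨂[ℂ]^(n + 2) M2}
    (hx : x ∈ projKernel q (n + 2)) :
    slice n 1 (slice (n + 1) 0 x) = (q : ℂ) • slice n 0 (slice (n + 1) 1 x) := by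
  have h0 := q.ne_zero
  have h := mem_projKernel.1 hx 1 (by simp)
  have h2 : (q : ℂ) + (q : ℂ)⁻¹ ≠ 0 := by
    intro h
    field_simp at h
    exact hq 4 (by norm_num) (by linear_combination ((q : ℂ) ^ 2 - 1) * h)
  have h3 : 1 - ((q : ℂ) ^ 2)⁻¹ ≠ 0 := by
    intro h
    field_simp at h
    exact q.sq_ne_one (by linear_combination h)
  have h4 : ((q : ℂ)⁻¹ - (q : ℂ)) / ((q : ℂ) + (q : ℂ)⁻¹) =
      -((1 - ((q : ℂ) ^ 2)⁻¹) / ((q : ℂ) + (q : ℂ)⁻¹)) * (q : ℂ) := by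
    rw [← neg_div, div_mul_eq_mul_div]
    congr 1
    field_simp
    ring
  rw [singletProjAt_one, h4, mul_smul, neg_smul, neg_add_eq_zero] at h
  exact (smul_right_injective _ (div_ne_zero h3 h2) h).symm

/-- The coefficients `q + q ^ 3 + ⋯ + q ^ (2 d - 1)`. -/
def oddPowSum (q : ℂ) (d : ℕ) : ℂ := q * ∑ i ∈ Finset.range d, (q ^ 2) ^ i

theorem oddPowSum_succ (z : ℂ) (d : ℕ) : oddPowSum z (d + 1) = z * (z * oddPowSum z d + 1) := by
  rw [oddPowSum, oddPowSum, geom_sum_succ]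
  ring

/-- E turns one e₁ into e₀. By q-symmetry all resulting terms are multiples of the slice with last
factor e₁, and the powers of q add up to `oddPowSum`. The induction compares both slices, using the
exchange rule and the recursion `oddPowSum_succ`. -/
theorem E_slice_zero_of_mem_projKernel (hq : ∀ n : ℕ, n ≠ 0 → (q : ℂ) ^ n ≠ 1)
    {n d : ℕ} {x : ⨂[ℂ]^(n + 1) M2}
    (hw : x ∈ weightSpace q (n + 1) d) (hx : x ∈ projKernel q (n + 1)) :
    rep q n (gen q Gen.E) (slice n 0 x) = oddPowSum q d • slice n 1 x := by
  have h0 := q.ne_zero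
  obtain ⟨w0, w1⟩ := mem_weightSpace_succ.1 hw
  induction n generalizing d with
  | zero =>
    cases d with
    | zero => simp [rep_zero_E, oddPowSum]
    | succ d =>
      rw [weightSpace_eq_bot hq (Or.inr (by push_cast; omega)), Submodule.mem_bot] at w1
      rw [rep_zero_E, w1, smul_zero]
  | succ n ih =>
    have hs := slice_one_zero_of_mem_projKernel hq hx
    have k1 := ih w1 (slice_mem_projKernel hx 1) (mem_weightSpace_succ.1 w1).1
      (mem_weightSpace_succ.1 w1).2
    refine ext_slice ?_ ?_
    · rw [slice_zero_E, map_smul]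
      cases d with
      | zero =>
        rw [weightSpace_eq_bot hq (Or.inl (by simp)), Submodule.mem_bot] at w0
        simp [w0, oddPowSum]
      | succ d =>
        rw [Nat.cast_add, Nat.cast_one, add_sub_cancel_right] at w0
        rw [ih w0 (slice_mem_projKernel hx 0) (mem_weightSpace_succ.1 w0).1
          (mem_weightSpace_succ.1 w0).2, hs, oddPowSum_succ]
        module
    · rw [slice_one_E, hs, map_smul, smul_smul, inv_mul_cancel₀ h0, one_smul, k1, map_smul]

/-- The condition d < n excludes e₀ ⊗ ⋯ ⊗ e₀, which E and all projections do annihilate. -/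
theorem eq_zero_of_mem_projKernel (hq : ∀ n : ℕ, n ≠ 0 → (q : ℂ) ^ n ≠ 1)
    {n d : ℕ} (hd : d < n) {x : ⨂[ℂ]^n M2}
    (hw : x ∈ weightSpace q n d) (hx : x ∈ projKernel q n) (hE : rep q n (gen q Gen.E) x = 0) :
    x = 0 := by
  induction n generalizing d with
  | zero => omega
  | succ n ih =>
    have hs := E_slice_zero_of_mem_projKernel hq hw hx
    have h1 : slice n 1 x = 0 := by
      have h := slice_zero_E q n x
      rw [hE, map_zero, hs, smul_smul] at h
      have h' : ((q : ℂ) * oddPowSum q d + 1) • slice n 1 x = 0 := by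
        rw [add_smul, one_smul]; exact h.symm
      -- The scalar is 1 + q^2 + ⋯ + q^(2d). If it vanished, multiplying by q^2 - 1 would give
      -- q^(2(d+1)) = 1.
      refine (smul_eq_zero.1 h').resolve_left fun h'' => ?_
      have h3 := mul_geom_sum ((q : ℂ) ^ 2) (d + 1)
      rw [geom_sum_succ] at h3
      have h4 : ((q : ℂ) ^ 2) ^ (d + 1) = 1 := by
        rw [oddPowSum] at h''
        linear_combination ((q : ℂ) ^ 2 - 1) * h'' - h3
      rw [← pow_mul] at h4
      exact hq _ (by omega) h4
    -- The other slice satisfies the same hypotheses with n and d both lowered by one, so d < n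
    -- persists.
    obtain ⟨w0, -⟩ := mem_weightSpace_succ.1 hw
    refine ext_slice ?_ (by rw [h1, map_zero])
    rw [map_zero]
    cases d with
    | zero => rwa [weightSpace_eq_bot hq (Or.inl (by simp)), Submodule.mem_bot] at w0
    | succ d =>
      rw [Nat.cast_add, Nat.cast_one, add_sub_cancel_right] at w0
      exact ih (by omega) w0 (slice_mem_projKernel hx 0) (by rw [hs, h1, smul_zero])

theorem eq_zero_of_singletProjAt_eq_zero (hq : ∀ n : ℕ, n ≠ 0 → (q : ℂ) ^ n ≠ 1)
    {N : ℕ} {x : ⨂[ℂ]^(2 * (N + 1)) M2}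
    (hx : x ∈ singletSpace q (N + 1))
    (h : ∀ j ∈ Finset.Icc 1 (2 * N + 1), singletProjAt q (2 * N) j x = 0) : x = 0 :=
  eq_zero_of_mem_projKernel hq (by omega) hx.1 (mem_projKernel (n := 2 * N).2 h) hx.2

end kernel

/-! ### Combinatorics of link patterns -/

namespace LinkPattern

variable {N : ℕ}

theorem eq_of_endpoint (α : LinkPattern N) {l m : ℕ × ℕ} (hl : l ∈ α.links) (hm : m ∈ α.links)
    {i : ℕ} (hli : l.1 = i ∨ l.2 = i) (hmi : m.1 = i ∨ m.2 = i) : l = m := by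
  have h1 := α.one_le l hl
  have h2 := α.lt l hl
  have h3 := α.le_two_mul l hl
  exact (α.cover i (Finset.mem_Icc.2 ⟨by omega, by omega⟩)).unique ⟨hl, hli⟩ ⟨hm, hmi⟩

/-- Otherwise the four factors in the planarity condition have signs whose product is at most zero;
the weak signs also cover a common right endpoint. -/
theorem nested (α : LinkPattern N) {l m : ℕ × ℕ} (hl : l ∈ α.links) (hm : m ∈ α.links)
    (h1 : l.1 < m.1) (h2 : m.1 < l.2) : m.2 < l.2 := by
  by_contra! h
  have hp := α.planar l hl m hm (by rintro rfl; omega)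
  have h3 := α.lt m hm
  have a1 : (l.1 : ℤ) - m.1 ≤ 0 := by omega
  have a2 : (l.2 : ℤ) - m.2 ≤ 0 := by omega
  have a3 : 0 ≤ (l.2 : ℤ) - m.1 := by omega
  have a4 : (l.1 : ℤ) - m.2 ≤ 0 := by omega
  have := mul_nonpos_of_nonneg_of_nonpos (mul_nonneg (mul_nonneg_of_nonpos_of_nonpos a1 a2) a3) a4
  omega

/-- Take a link of minimal length. If its endpoints were not adjacent, the link at the point after
its left endpoint would be nested inside it, hence shorter, or would cross it. -/
theorem exists_short (α : LinkPattern (N + 1)) : ∃ j, (j, j + 1) ∈ α.links := by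
  obtain ⟨l0, ⟨hl0, -⟩, -⟩ := α.cover 1 (Finset.mem_Icc.2 ⟨le_rfl, by omega⟩)
  obtain ⟨l, hl, hmin⟩ := α.links.exists_min_image (fun l => l.2 - l.1) ⟨l0, hl0⟩
  have h1 := α.one_le l hl
  have h2 := α.lt l hl
  have h3 := α.le_two_mul l hl
  by_cases h : l.2 = l.1 + 1
  · exact ⟨l.1, by rw [← h]; exact hl⟩
  exfalso
  obtain ⟨m, ⟨hm, hmi⟩, -⟩ := α.cover (l.1 + 1) (Finset.mem_Icc.2 ⟨by omega, by omega⟩)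
  have hlt := α.lt m hm
  rcases hmi with hmi | hmi
  · have := α.nested hl hm (by omega) (by omega)
    have := hmin m hm
    omega
  · by_cases he : m.1 = l.1
    · have := α.eq_of_endpoint hm hl (Or.inl he) (Or.inl rfl)
      subst this
      omega
    · have := α.nested hm hl (by omega) (by omega)
      omega

theorem short_disjoint (α : LinkPattern N) {i j : ℕ} (hi : (i, i + 1) ∈ α.links)
    (hj : (j, j + 1) ∈ α.links) (h : i < j) : i + 2 ≤ j := by
  by_contra! h'
  obtain rfl : j = i + 1 := by omega
  have := α.eq_of_endpoint hi hj (i := i + 1) (Or.inr rfl) (Or.inl rfl)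
  simp at this

theorem mem_remove {α : LinkPattern (N + 1)} {j : ℕ} {hj : (j, j + 1) ∈ α.links} {m : ℕ × ℕ} :
    m ∈ (α.remove j hj).links ↔
      ∃ l ∈ α.links, l ≠ (j, j + 1) ∧ Prod.map (relabel j) (relabel j) l = m := by
  simp [remove, and_assoc, and_left_comm]

theorem links_subset_of_remove_eq {α β : LinkPattern (N + 1)} {j : ℕ} (hα : (j, j + 1) ∈ α.links)
    (hβ : (j, j + 1) ∈ β.links) (h : α.remove j hα = β.remove j hβ) : α.links ⊆ β.links := by
  intro l hl
  by_cases hne : l = (j, j + 1)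
  · rwa [hne]
  have hm : Prod.map (relabel j) (relabel j) l ∈ (α.remove j hα).links :=
    mem_remove.2 ⟨l, hl, hne, rfl⟩
  rw [h] at hm
  obtain ⟨k, hk, hkne, hkl⟩ := mem_remove.1 hm
  obtain ⟨a1, a2, a3, a4⟩ := α.endpoint_ne hα (Finset.mem_erase.2 ⟨hne, hl⟩)
  obtain ⟨b1, b2, b3, b4⟩ := β.endpoint_ne hβ (Finset.mem_erase.2 ⟨hkne, hk⟩)
  rw [Prod.ext_iff] at hkl
  rwa [← Prod.ext (relabel_inj b1 b2 a1 a2 hkl.1) (relabel_inj b3 b4 a3 a4 hkl.2)]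

theorem remove_injective {α β : LinkPattern (N + 1)} {j : ℕ} (hα : (j, j + 1) ∈ α.links)
    (hβ : (j, j + 1) ∈ β.links) (h : α.remove j hα = β.remove j hβ) : α = β :=
  LinkPattern.ext ((links_subset_of_remove_eq hα hβ h).antisymm
    (links_subset_of_remove_eq hβ hα h.symm))

theorem mem_remove_left {α : LinkPattern (N + 1)} {i j : ℕ} (hi : (i, i + 1) ∈ α.links)
    (hj : (j, j + 1) ∈ α.links) (h : i + 2 ≤ j) : (i, i + 1) ∈ (α.remove j hj).links := by
  refine mem_remove.2 ⟨_, hi, by simp only [ne_eq, Prod.mk.injEq]; omega, ?_⟩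
  simp only [Prod.map_apply, relabel, Prod.mk.injEq]
  split_ifs <;> omega

theorem mem_remove_right {α : LinkPattern (N + 1)} {i k : ℕ} (hi : (i, i + 1) ∈ α.links)
    (hj : (i + k + 2, i + k + 2 + 1) ∈ α.links) :
    (i + k, i + k + 1) ∈ (α.remove i hi).links := by
  refine mem_remove.2 ⟨_, hj, by simp only [ne_eq, Prod.mk.injEq]; omega, ?_⟩
  simp only [Prod.map_apply, relabel, Prod.mk.injEq]
  split_ifs <;> omega

theorem relabel_comm (i k a : ℕ) :
    relabel i (relabel (i + k + 2) a) = relabel (i + k) (relabel i a) := by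
  simp only [relabel]
  split_ifs <;> omega

/-- Combinatorial counterpart of `singletProjAt_comm`: removing the left link first moves the other
from i + k + 2 to i + k. -/
theorem remove_comm {α : LinkPattern (N + 2)} {i k : ℕ} (hi : (i, i + 1) ∈ α.links)
    (hj : (i + k + 2, i + k + 2 + 1) ∈ α.links) :
    (α.remove (i + k + 2) hj).remove i (mem_remove_left hi hj (by omega)) =
      (α.remove i hi).remove (i + k) (mem_remove_right hi hj) := by
  have ne : ∀ {j : ℕ} (_ : (j, j + 1) ∈ α.links) {l : ℕ × ℕ}, l ∈ α.links → l ≠ (j, j + 1) →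
      l.1 ≠ j ∧ l.1 ≠ j + 1 ∧ l.2 ≠ j ∧ l.2 ≠ j + 1 :=
    fun hj l hl hne => α.endpoint_ne hj (Finset.mem_erase.2 ⟨hne, hl⟩)
  ext m
  simp only [mem_remove]
  constructor
  · rintro ⟨-, ⟨l, hl, hlj, rfl⟩, hli, rfl⟩
    have hli' : l ≠ (i, i + 1) := by
      rintro rfl
      apply hli
      simp only [Prod.map_apply, relabel, Prod.mk.injEq]
      split_ifs <;> omega
    obtain ⟨a1, a2, a3, a4⟩ := ne hi hl hli'
    obtain ⟨b1, b2, b3, b4⟩ := ne hj hl hlj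
    refine ⟨_, ⟨l, hl, hli', rfl⟩, ?_, ?_⟩
    · intro h
      simp only [Prod.ext_iff, Prod.map_fst, relabel] at h
      split_ifs at h <;> omega
    · simp only [Prod.ext_iff, Prod.map_fst, Prod.map_snd]
      exact ⟨(relabel_comm i k _).symm, (relabel_comm i k _).symm⟩
  · rintro ⟨-, ⟨l, hl, hli, rfl⟩, hlj, rfl⟩
    have hlj' : l ≠ (i + k + 2, i + k + 2 + 1) := by
      rintro rfl
      apply hlj
      simp only [Prod.map_apply, relabel, Prod.mk.injEq]
      split_ifs <;> omega
    obtain ⟨a1, a2, a3, a4⟩ := ne hi hl hli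
    obtain ⟨b1, b2, b3, b4⟩ := ne hj hl hlj'
    refine ⟨_, ⟨l, hl, hlj', rfl⟩, ?_, ?_⟩
    · intro h
      simp only [Prod.ext_iff, Prod.map_fst, relabel] at h
      split_ifs at h <;> omega
    · simp only [Prod.ext_iff, Prod.map_fst, Prod.map_snd]
      exact ⟨relabel_comm i k _, relabel_comm i k _⟩

/-! ### Insertion of a short link -/

/-- The relabeling of indices before insertion of a link between `j` and `j + 1`. -/
def raise (j i : ℕ) : ℕ := if i < j then i else i + 2

theorem raise_ne (j i : ℕ) : raise j i ≠ j ∧ raise j i ≠ j + 1 := by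
  simp only [raise]
  split_ifs <;> omega

theorem relabel_raise (j i : ℕ) : relabel j (raise j i) = i := by
  simp only [relabel, raise]
  split_ifs <;> omega

theorem raise_relabel {j i : ℕ} (h1 : i ≠ j) (h2 : i ≠ j + 1) : raise j (relabel j i) = i := by
  simp only [relabel, raise]
  split_ifs <;> omega

theorem sign_raise_sub (j a b : ℕ) :
    SignType.sign ((raise j a : ℤ) - raise j b) = SignType.sign ((a : ℤ) - b) := by
  rw [← sign_relabel_sub (raise_ne j a).1 (raise_ne j a).2 (raise_ne j b).1 (raise_ne j b).2,
    relabel_raise, relabel_raise]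

theorem mul_succ_pos_of_ne {x : ℤ} (h0 : x ≠ 0) (h1 : x + 1 ≠ 0) : 0 < x * (x + 1) := by
  rcases lt_or_gt_of_ne h0 with h | h
  · exact mul_pos_of_neg_of_neg h (by omega)
  · exact mul_pos h (by omega)

/-- With x and y the differences of j and the raised points, the product is x(x+1) · y(y+1), and
neither x nor y is 0 or -1. -/
theorem planar_short_raise (j a b : ℕ) :
    0 < ((j : ℤ) - raise j a) * (((j + 1 : ℕ) : ℤ) - raise j b) *
      (((j + 1 : ℕ) : ℤ) - raise j a) * ((j : ℤ) - raise j b) := by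
  have ha := raise_ne j a
  have hb := raise_ne j b
  have h1 := mul_succ_pos_of_ne (x := (j : ℤ) - raise j a) (by omega) (by omega)
  have h2 := mul_succ_pos_of_ne (x := (j : ℤ) - raise j b) (by omega) (by omega)
  have h3 := mul_pos h1 h2
  push_cast
  linarith

/-- The link pattern obtained from `β` by insertion of a link between `j` and `j + 1`. -/
def insert (β : LinkPattern N) (j : ℕ) (hj : j ∈ Finset.Icc 1 (2 * N + 1)) :
    LinkPattern (N + 1) where
  links := Insert.insert (j, j + 1) (β.links.image (Prod.map (raise j) (raise j)))
  one_le := by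
    rw [Finset.mem_Icc] at hj
    intro m hm
    rcases Finset.mem_insert.1 hm with rfl | hm
    · exact hj.1
    · obtain ⟨l, hl, rfl⟩ := Finset.mem_image.1 hm
      have h1 := β.one_le l hl
      simp only [Prod.map_fst, raise]
      split_ifs <;> omega
  lt := by
    intro m hm
    rcases Finset.mem_insert.1 hm with rfl | hm
    · exact Nat.lt_succ_self j
    · obtain ⟨l, hl, rfl⟩ := Finset.mem_image.1 hm
      have h1 := β.lt l hl
      simp only [Prod.map_fst, Prod.map_snd, raise]
      split_ifs <;> omega
  le_two_mul := by
    rw [Finset.mem_Icc] at hj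
    intro m hm
    rcases Finset.mem_insert.1 hm with rfl | hm
    · simp only; omega
    · obtain ⟨l, hl, rfl⟩ := Finset.mem_image.1 hm
      have h1 := β.le_two_mul l hl
      simp only [Prod.map_snd, raise]
      split_ifs <;> omega
  cover := by
    rw [Finset.mem_Icc] at hj
    intro i hi
    rw [Finset.mem_Icc] at hi
    by_cases h : i = j ∨ i = j + 1
    · refine ⟨(j, j + 1), ⟨Finset.mem_insert_self _ _, by simp only; omega⟩, ?_⟩
      rintro m ⟨hm, hmi⟩
      rcases Finset.mem_insert.1 hm with rfl | hm
      · rfl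
      · obtain ⟨l, hl, rfl⟩ := Finset.mem_image.1 hm
        have h1 := raise_ne j l.1
        have h2 := raise_ne j l.2
        simp only [Prod.map_fst, Prod.map_snd] at hmi
        omega
    · have hr := raise_relabel (j := j) (i := i) (by omega) (by omega)
      have hi' : relabel j i ∈ Finset.Icc 1 (2 * N) := by
        rw [Finset.mem_Icc, relabel]
        split_ifs <;> omega
      obtain ⟨l, ⟨hl, hli⟩, huniq⟩ := β.cover _ hi'
      refine ⟨Prod.map (raise j) (raise j) l,
        ⟨Finset.mem_insert_of_mem (Finset.mem_image_of_mem _ hl), ?_⟩, ?_⟩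
      · simp only [Prod.map_fst, Prod.map_snd]
        exact hli.imp (fun h => by rw [h, hr]) fun h => by rw [h, hr]
      · rintro m ⟨hm, hmi⟩
        rcases Finset.mem_insert.1 hm with rfl | hm
        · simp only at hmi; omega
        · obtain ⟨k, hk, rfl⟩ := Finset.mem_image.1 hm
          rw [huniq k ⟨hk, ?_⟩]
          simp only [Prod.map_fst, Prod.map_snd] at hmi
          exact hmi.imp (fun h => by rw [← h, relabel_raise]) fun h => by rw [← h, relabel_raise]
  planar := by
    intro l' hl' m' hm' hne
    rcases Finset.mem_insert.1 hl' with rfl | hl' <;> rcases Finset.mem_insert.1 hm' with rfl | hm'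
    · exact absurd rfl hne
    · obtain ⟨m, hm, rfl⟩ := Finset.mem_image.1 hm'
      exact planar_short_raise j m.1 m.2
    · obtain ⟨l, hl, rfl⟩ := Finset.mem_image.1 hl'
      have h := planar_short_raise j l.1 l.2
      simp only [Prod.map_fst, Prod.map_snd]
      linarith
    · obtain ⟨l, hl, rfl⟩ := Finset.mem_image.1 hl'
      obtain ⟨m, hm, rfl⟩ := Finset.mem_image.1 hm'
      have h := β.planar l hl m hm (by rintro rfl; exact hne rfl)
      rw [← sign_eq_one_iff, sign_mul, sign_mul, sign_mul] at h ⊢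
      rw [Prod.map_fst, Prod.map_fst, Prod.map_snd, Prod.map_snd, sign_raise_sub, sign_raise_sub,
        sign_raise_sub, sign_raise_sub]
      exact h

theorem mem_insert_self (β : LinkPattern N) (j : ℕ) (hj : j ∈ Finset.Icc 1 (2 * N + 1)) :
    (j, j + 1) ∈ (β.insert j hj).links :=
  Finset.mem_insert_self _ _

theorem remove_insert (β : LinkPattern N) (j : ℕ) (hj : j ∈ Finset.Icc 1 (2 * N + 1)) :
    (β.insert j hj).remove j (β.mem_insert_self j hj) = β := by
  have hmap : ∀ l : ℕ × ℕ, Prod.map (relabel j) (relabel j) (Prod.map (raise j) (raise j) l) = l :=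
    fun l => by simp [Prod.ext_iff, relabel_raise]
  ext m
  rw [mem_remove]
  constructor
  · rintro ⟨l, hl, hne, rfl⟩
    obtain ⟨k, hk, rfl⟩ := Finset.mem_image.1 ((Finset.mem_insert.1 hl).resolve_left hne)
    rwa [hmap]
  · intro hm
    refine ⟨_, Finset.mem_insert_of_mem (Finset.mem_image_of_mem _ hm), ?_, hmap m⟩
    intro h
    exact (raise_ne j m.1).1 (congrArg Prod.fst h)

/-- Insertion at j is injective with image the patterns containing {j, j+1}; all other terms are
zero. -/
theorem sum_remove {M : Type*} [AddCommMonoid M] (f : LinkPattern N → M) (j : ℕ)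
    (hj : j ∈ Finset.Icc 1 (2 * N + 1)) :
    ∑ α : LinkPattern (N + 1), (if h : (j, j + 1) ∈ α.links then f (α.remove j h) else 0) =
      ∑ β, f β := by
  have hinj : Function.Injective fun β : LinkPattern N => β.insert j hj := fun β γ h => by
    rw [← β.remove_insert j hj, ← γ.remove_insert j hj]
    congr 1
  symm
  refine Fintype.sum_of_injective _ hinj _ _ ?_ ?_
  · intro α hα
    rw [dif_neg]
    exact fun h => hα ⟨α.remove j h, remove_injective (mem_insert_self _ _ _) h (remove_insert _ _ _)⟩
  · intro β
    rw [dif_pos (β.mem_insert_self j hj), remove_insert]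

/-! ### Counting link patterns -/

instance : Subsingleton (LinkPattern 0) where
  allEq α β := by
    have h : ∀ γ : LinkPattern 0, γ.links = ∅ := fun γ => by
      rw [Finset.eq_empty_iff_forall_notMem]
      intro l hl
      have h1 := γ.lt l hl
      have h2 := γ.le_two_mul l hl
      omega
    exact LinkPattern.ext ((h α).trans (h β).symm)

/-- The set of left endpoints of the links. -/
def leftEnds (α : LinkPattern N) : Finset ℕ := α.links.image Prod.fst

/-- A left endpoint directly followed by a right endpoint must be linked to it, since otherwise the
two links would cross. Short links are thus visible in `leftEnds`. -/
theorem short_mem_of_leftEnds_eq {α β : LinkPattern N} (h : α.leftEnds = β.leftEnds) {j : ℕ}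
    (hj : (j, j + 1) ∈ α.links) : (j, j + 1) ∈ β.links := by
  have h1 : j ∈ β.leftEnds := h ▸ Finset.mem_image_of_mem Prod.fst hj
  have h2 : j + 1 ∉ β.leftEnds := by
    rw [← h, leftEnds, Finset.mem_image]
    rintro ⟨l, hl, hlj⟩
    have := α.eq_of_endpoint hl hj (Or.inl hlj) (Or.inr rfl)
    subst this
    simp at hlj
  obtain ⟨l, hl, rfl⟩ := Finset.mem_image.1 h1
  have hle := α.le_two_mul _ hj
  simp only at hle
  obtain ⟨m, ⟨hm, hmi⟩, -⟩ := β.cover (l.1 + 1) (Finset.mem_Icc.2 ⟨by omega, by omega⟩)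
  have hmi := hmi.resolve_left fun h => h2 (Finset.mem_image.2 ⟨m, hm, h⟩)
  have hlm := β.lt m hm
  have hll := β.lt l hl
  by_cases he : m.1 = l.1
  · rwa [← hmi, ← he]
  · have := β.nested hm hl (by omega) (by omega)
    omega

theorem leftEnds_remove (α : LinkPattern (N + 1)) {j : ℕ} (hj : (j, j + 1) ∈ α.links) :
    (α.remove j hj).leftEnds = (α.leftEnds.erase j).image (relabel j) := by
  ext i
  simp only [leftEnds, Finset.mem_image, Finset.mem_erase]
  constructor
  · rintro ⟨m, hm, rfl⟩
    obtain ⟨l, hl, hne, rfl⟩ := mem_remove.1 hm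
    exact ⟨l.1, ⟨(α.endpoint_ne hj (Finset.mem_erase.2 ⟨hne, hl⟩)).1, l, hl, rfl⟩, rfl⟩
  · rintro ⟨_, ⟨hne, l, hl, rfl⟩, rfl⟩
    exact ⟨_, mem_remove.2 ⟨l, hl, by rintro rfl; exact hne rfl, rfl⟩, rfl⟩

/-- Peel off a short link, which both patterns share, and induct. -/
theorem leftEnds_injective : Function.Injective (leftEnds : LinkPattern N → Finset ℕ) := by
  induction N with
  | zero => exact Function.injective_of_subsingleton _
  | succ N ih =>
    intro α β h
    obtain ⟨j, hj⟩ := α.exists_short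
    have hj' := short_mem_of_leftEnds_eq h hj
    exact remove_injective hj hj' (ih (by rw [leftEnds_remove, leftEnds_remove, h]))

/-- The up and down steps associated with the left and right endpoints of links. -/
def step (α : LinkPattern N) (i : ℕ) : DyckStep :=
  -- Positions in the word start at 0, endpoints of links at 1.
  if i + 1 ∈ α.leftEnds then DyckStep.U else DyckStep.D

theorem card_filter_fst_eq (α : LinkPattern N) (i : ℕ) :
    (α.links.filter fun l => l.1 = i).card = if i ∈ α.leftEnds then 1 else 0 := by
  split_ifs with h
  · obtain ⟨l, hl, rfl⟩ := Finset.mem_image.1 h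
    rw [Finset.card_eq_one]
    refine ⟨l, Finset.eq_singleton_iff_unique_mem.2 ⟨Finset.mem_filter.2 ⟨hl, rfl⟩, ?_⟩⟩
    intro m hm
    rw [Finset.mem_filter] at hm
    exact α.eq_of_endpoint hm.1 hl (Or.inl hm.2) (Or.inl rfl)
  · rw [Finset.card_eq_zero, Finset.filter_eq_empty_iff]
    exact fun {l} hl hli => h (Finset.mem_image.2 ⟨l, hl, hli⟩)

theorem card_filter_snd_eq (α : LinkPattern N) {i : ℕ} (hi : i ∈ Finset.Icc 1 (2 * N)) :
    (α.links.filter fun l => l.2 = i).card = if i ∈ α.leftEnds then 0 else 1 := by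
  split_ifs with h
  · obtain ⟨l, hl, rfl⟩ := Finset.mem_image.1 h
    rw [Finset.card_eq_zero, Finset.filter_eq_empty_iff]
    intro m hm hmi
    have := α.eq_of_endpoint hm hl (Or.inr hmi) (Or.inl rfl)
    subst this
    have := α.lt m hm
    omega
  · obtain ⟨l, ⟨hl, hli⟩, -⟩ := α.cover i hi
    have hli := hli.resolve_left fun h' => h (Finset.mem_image.2 ⟨l, hl, h'⟩)
    rw [Finset.card_eq_one]
    refine ⟨l, Finset.eq_singleton_iff_unique_mem.2 ⟨Finset.mem_filter.2 ⟨hl, hli⟩, ?_⟩⟩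
    intro m hm
    rw [Finset.mem_filter] at hm
    exact α.eq_of_endpoint hm.1 hl (Or.inr hm.2) (Or.inr hli)

theorem card_filter_le_succ (s : Finset (ℕ × ℕ)) (f : ℕ × ℕ → ℕ) (k : ℕ) :
    (s.filter fun l => f l ≤ k + 1).card =
      (s.filter fun l => f l ≤ k).card + (s.filter fun l => f l = k + 1).card := by
  rw [← Finset.card_union_of_disjoint, ← Finset.filter_or]
  · congr 1
    ext l
    simp only [Finset.mem_filter]
    refine and_congr_right fun _ => ?_
    omega
  · rw [Finset.disjoint_filter]
    intro l _ h
    omega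

theorem count_step_U (α : LinkPattern N) (k : ℕ) :
    ((List.range k).map α.step).count DyckStep.U = (α.links.filter fun l => l.1 ≤ k).card := by
  induction k with
  | zero =>
    symm
    rw [List.range_zero, List.map_nil, List.count_nil, Finset.card_eq_zero,
      Finset.filter_eq_empty_iff]
    intro l hl h
    have := α.one_le l hl
    omega
  | succ k ih =>
    rw [card_filter_le_succ, card_filter_fst_eq, List.range_succ, List.map_append,
      List.count_append, ih]
    congr 1
    by_cases h : k + 1 ∈ α.leftEnds <;> simp [step, h]

theorem count_step_D (α : LinkPattern N) {k : ℕ} (hk : k ≤ 2 * N) :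
    ((List.range k).map α.step).count DyckStep.D = (α.links.filter fun l => l.2 ≤ k).card := by
  induction k with
  | zero =>
    symm
    rw [List.range_zero, List.map_nil, List.count_nil, Finset.card_eq_zero,
      Finset.filter_eq_empty_iff]
    intro l hl h
    have := α.lt l hl
    omega
  | succ k ih =>
    rw [card_filter_le_succ, card_filter_snd_eq α (Finset.mem_Icc.2 ⟨by omega, hk⟩),
      List.range_succ, List.map_append, List.count_append, ih (by omega)]
    congr 1
    by_cases h : k + 1 ∈ α.leftEnds <;> simp [step, h]

/-- The Dyck word of a link pattern. -/
def toDyckWord (α : LinkPattern N) : DyckWord where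
  toList := (List.range (2 * N)).map α.step
  count_U_eq_count_D := by
    rw [count_step_U, count_step_D α le_rfl]
    congr 1
    refine Finset.filter_congr fun l hl => ?_
    have h1 := α.lt l hl
    have h2 := α.le_two_mul l hl
    omega
  count_D_le_count_U k := by
    rw [← List.map_take, List.take_range, count_step_U, count_step_D α (min_le_right _ _)]
    -- A link whose right endpoint is among the first k points has its left endpoint there as well.
    refine Finset.card_le_card fun l hl => ?_
    rw [Finset.mem_filter] at hl ⊢
    have h1 := α.lt l hl.1
    exact ⟨hl.1, by omega⟩

theorem semilength_toDyckWord (α : LinkPattern N) : α.toDyckWord.semilength = N := by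
  have h := α.toDyckWord.two_mul_semilength_eq_length
  have h' : α.toDyckWord.toList.length = 2 * N := by simp [toDyckWord]
  omega

theorem toDyckWord_injective : Function.Injective (toDyckWord : LinkPattern N → DyckWord) := by
  have key : ∀ {α β : LinkPattern N}, α.toDyckWord = β.toDyckWord → α.leftEnds ⊆ β.leftEnds := by
    intro α β h i hi
    have h' : ∀ k < 2 * N, α.step k = β.step k := by
      simpa [toDyckWord] using h
    obtain ⟨l, hl, rfl⟩ := Finset.mem_image.1 hi
    have h1 := α.one_le l hl
    have h2 := α.lt l hl
    have h3 := α.le_two_mul l hl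
    have h4 := h' (l.1 - 1) (by omega)
    rw [step, step, Nat.sub_add_cancel h1, if_pos hi] at h4
    by_contra hn
    rw [if_neg hn] at h4
    cases h4
  exact fun α β h => leftEnds_injective ((key h).antisymm (key h.symm))

/-- An injection suffices: the reverse inequality is not needed for `linkEval_bijective`. -/
theorem card_le_catalan (N : ℕ) : Fintype.card (LinkPattern N) ≤ catalan N := by
  rw [← DyckWord.card_dyckWord_semilength_eq_catalan]
  exact Fintype.card_le_of_injective
    (fun α => (⟨α.toDyckWord, α.semilength_toDyckWord⟩ : {p : DyckWord // p.semilength = N}))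
    fun α β h => toDyckWord_injective (congrArg Subtype.val h)

end LinkPattern

/-! ### The functionals indexed by link patterns -/

/-- The functional obtained by successive projections along short links of a link pattern. -/
def linkFunctional (q : QParam) : (N : ℕ) → LinkPattern N → (⨂[ℂ]^(2 * N) M2 →ₗ[ℂ] ℂ)
  | 0, _ => (PiTensorProduct.isEmptyEquiv (Fin 0)).toLinearMap
  | N + 1, α =>
    linkFunctional q N (α.remove α.exists_short.choose α.exists_short.choose_spec) ∘ₗ
      singletProjAt q (2 * N) α.exists_short.choose

/-- The diamond step for independence of order: after removing either of two short links, remove the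
other next. The two results agree because removals commute and projections commute. -/
theorem linkFunctional_remove_eq {q : QParam} {N : ℕ}
    (ih : ∀ (α : LinkPattern (N + 1)) (j : ℕ) (hj : (j, j + 1) ∈ α.links)
      (x : ⨂[ℂ]^(2 * (N + 1)) M2), linkFunctional q (N + 1) α x =
        linkFunctional q N (α.remove j hj) (singletProjAt q (2 * N) j x))
    (α : LinkPattern (N + 2)) {i j : ℕ} (hi : (i, i + 1) ∈ α.links) (hj : (j, j + 1) ∈ α.links)
    (hij : i < j) (x : ⨂[ℂ]^(2 * (N + 2)) M2) :
    linkFunctional q (N + 1) (α.remove i hi) (singletProjAt q (2 * (N + 1)) i x) =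
      linkFunctional q (N + 1) (α.remove j hj) (singletProjAt q (2 * (N + 1)) j x) := by
  have h := α.short_disjoint hi hj hij
  have h1 := α.one_le _ hi
  have h2 := α.le_two_mul _ hj
  simp only at h1 h2
  obtain ⟨k, rfl⟩ : ∃ k, j = i + k + 2 := ⟨j - i - 2, by omega⟩
  rw [ih _ (i + k) (LinkPattern.mem_remove_right hi hj),
    ih _ i (LinkPattern.mem_remove_left hi hj (by omega)), LinkPattern.remove_comm hi hj]
  congr 1
  obtain ⟨m, rfl⟩ : ∃ m, i = m + 1 := ⟨i - 1, by omega⟩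
  rw [show m + 1 + k = m + k + 1 by ring]
  exact singletProjAt_comm q (2 * N) m k x (by omega)

/-- The functional does not depend on the short links chosen in its definition. -/
theorem linkFunctional_succ (q : QParam) (N : ℕ) (α : LinkPattern (N + 1)) (j : ℕ)
    (hj : (j, j + 1) ∈ α.links) (x : ⨂[ℂ]^(2 * (N + 1)) M2) :
    linkFunctional q (N + 1) α x =
      linkFunctional q N (α.remove j hj) (singletProjAt q (2 * N) j x) := by
  induction N generalizing j with
  | zero =>
    have hs := α.exists_short.choose_spec
    have h1 := α.one_le _ hj
    have h2 := α.le_two_mul _ hj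
    have h3 := α.one_le _ hs
    have h4 := α.le_two_mul _ hs
    simp only at h1 h2 h3 h4
    -- Only the points 1 and 2 are available, so both indices are 1.
    obtain rfl : j = α.exists_short.choose := by omega
    rfl
  | succ N ih =>
    have hs := α.exists_short.choose_spec
    rcases lt_trichotomy α.exists_short.choose j with h | h | h
    · exact linkFunctional_remove_eq ih α hs hj h x
    · subst h
      rfl
    · exact (linkFunctional_remove_eq ih α hj hs h x).symm

/-- The evaluation of all functionals on the highest weight vectors of weight zero. -/
def linkEval (q : QParam) (N : ℕ) : singletSpace q N →ₗ[ℂ] (LinkPattern N → ℂ) :=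
  LinearMap.pi fun α => linkFunctional q N α ∘ₗ (singletSpace q N).subtype

theorem rep_zero_mem_singletSpace (q : QParam) (x : ⨂[ℂ]^(2 * 0) M2) : x ∈ singletSpace q 0 :=
  mem_singletSpace.2 ⟨rep_zero_K q x, rep_zero_E q x⟩

instance : Unique (LinkPattern 0) where
  default := ⟨∅, by simp, by simp, by simp, by simp, by simp⟩
  uniq _ := Subsingleton.elim _ _

/-- Every functional one level down, composed with a projection, is the functional of the pattern
with the link inserted. Inductively all projections of x vanish. -/
theorem eq_zero_of_linkFunctional_eq_zero {q : QParam} (hq : ∀ n : ℕ, n ≠ 0 → (q : ℂ) ^ n ≠ 1)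
    {N : ℕ} {x : ⨂[ℂ]^(2 * N) M2} (hx : x ∈ singletSpace q N)
    (h : ∀ α, linkFunctional q N α x = 0) : x = 0 := by
  induction N with
  | zero => exact (PiTensorProduct.isEmptyEquiv (Fin 0)).map_eq_zero_iff.1 (h default)
  | succ N ih =>
    refine eq_zero_of_singletProjAt_eq_zero hq hx fun j hj => ?_
    refine ih (singletProjAt_mem_singletSpace j hx) fun β => ?_
    have := linkFunctional_succ q N (β.insert j hj) j (β.mem_insert_self j hj) x
    rw [← h (β.insert j hj), this, LinkPattern.remove_insert]

theorem bijective_of_injective_of_card_le {V ι : Type*} [AddCommGroup V] [Module ℂ V]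
    [Fintype ι] (p : Submodule ℂ V) (f : p →ₗ[ℂ] (ι → ℂ)) (hf : Function.Injective f)
    (h : Fintype.card ι ≤ Module.finrank ℂ p) : Function.Bijective f := by
  have := FiniteDimensional.of_injective f hf
  rw [← Module.finrank_fintype_fun_eq_card ℂ] at h
  exact ⟨hf, (LinearMap.injective_iff_surjective_of_finrank_eq_finrank
    ((LinearMap.finrank_le_finrank_of_injective hf).antisymm h)).1 hf⟩

theorem linkEval_bijective {q : QParam} (hq : ∀ n : ℕ, n ≠ 0 → (q : ℂ) ^ n ≠ 1) (N : ℕ) :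
    Function.Bijective (linkEval q N) := by
  have hinj : Function.Injective (linkEval q N) := by
    intro x y h
    refine Subtype.ext (sub_eq_zero.1 ?_)
    refine eq_zero_of_linkFunctional_eq_zero hq (Submodule.sub_mem _ x.2 y.2) fun α => ?_
    rw [map_sub, sub_eq_zero]
    exact congrFun h α
  exact bijective_of_injective_of_card_le _ _ hinj
    ((LinkPattern.card_le_catalan N).trans (catalan_le_finrank_singletSpace hq N))

/-! ### Existence and uniqueness of the two families -/

section families

variable {q : QParam}

theorem IsPureFamily.ext (hq : ∀ n : ℕ, n ≠ 0 → (q : ℂ) ^ n ≠ 1)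
    {u u' : (N : ℕ) → LinkPattern N → ⨂[ℂ]^(2 * N) M2} (hu : IsPureFamily q u)
    (hu' : IsPureFamily q u') : u = u' := by
  have key : ∀ N α, u N α = u' N α := by
    intro N
    induction N with
    | zero => exact fun α => (hu.normalization α).trans (hu'.normalization α).symm
    | succ N ih =>
      intro α
      refine sub_eq_zero.1 (eq_zero_of_singletProjAt_eq_zero hq (Submodule.sub_mem _
        (mem_singletSpace.2 ⟨hu.cartan _ α, hu.highest _ α⟩)
        (mem_singletSpace.2 ⟨hu'.cartan _ α, hu'.highest _ α⟩)) fun j hj => ?_)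
      refine (map_sub (singletProjAt q (2 * N) j) (u (N + 1) α) (u' (N + 1) α)).trans ?_
      rw [sub_eq_zero]
      by_cases h : (j, j + 1) ∈ α.links
      · rw [hu.proj_of_mem N α j hj h, hu'.proj_of_mem N α j hj h, ih]
      · rw [hu.proj_of_notMem N α j hj h, hu'.proj_of_notMem N α j hj h]
  exact funext fun N => funext (key N)

theorem IsSymmetricFamily.ext (hq : ∀ n : ℕ, n ≠ 0 → (q : ℂ) ^ n ≠ 1)
    {v v' : (N : ℕ) → ⨂[ℂ]^(2 * N) M2} (hv : IsSymmetricFamily q v)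
    (hv' : IsSymmetricFamily q v') : v = v' := by
  funext N
  induction N with
  | zero => exact hv.normalization.trans hv'.normalization.symm
  | succ N ih =>
    refine sub_eq_zero.1 (eq_zero_of_singletProjAt_eq_zero hq (Submodule.sub_mem _
      (mem_singletSpace.2 ⟨hv.cartan _ N.succ_pos, hv.highest _ N.succ_pos⟩)
      (mem_singletSpace.2 ⟨hv'.cartan _ N.succ_pos, hv'.highest _ N.succ_pos⟩)) fun j hj => ?_)
    refine (map_sub (singletProjAt q (2 * N) j) (v (N + 1)) (v' (N + 1))).trans ?_
    rw [sub_eq_zero, hv.proj N j hj, hv'.proj N j hj, ih]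

/-- The family is the dual basis to the functionals. The projection equations are checked by
applying each functional for β: this gives 1 if inserting {j, j+1} into β yields α, and 0 otherwise.
-/
theorem exists_isPureFamily (hq : ∀ n : ℕ, n ≠ 0 → (q : ℂ) ^ n ≠ 1) :
    ∃ u : (N : ℕ) → LinkPattern N → ⨂[ℂ]^(2 * N) M2, IsPureFamily q u := by
  classical
  have hex : ∀ N (α : LinkPattern N), ∃ x ∈ singletSpace q N,
      ∀ β, linkFunctional q N β x = if β = α then 1 else 0 := by
    intro N α
    obtain ⟨x, hx⟩ := (linkEval_bijective hq N).2 fun β => if β = α then 1 else 0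
    exact ⟨x, x.2, congrFun hx⟩
  choose u hu huβ using hex
  have heq : ∀ {N} {x y : ⨂[ℂ]^(2 * N) M2}, x ∈ singletSpace q N → y ∈ singletSpace q N →
      (∀ β, linkFunctional q N β x = linkFunctional q N β y) → x = y := by
    intro N x y hx hy h
    have := (linkEval_bijective hq N).1 (a₁ := ⟨x, hx⟩) (a₂ := ⟨y, hy⟩) (funext h)
    exact congrArg Subtype.val this
  refine ⟨u, ⟨fun α => ?_, fun N α => (mem_singletSpace.1 (hu N α)).1,
    fun N α => (mem_singletSpace.1 (hu N α)).2, fun N α j hj h => ?_, fun N α j hj h => ?_⟩⟩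
  · refine heq (hu 0 α) (rep_zero_mem_singletSpace q _) fun β => ?_
    rw [huβ, if_pos (Subsingleton.elim β α)]
    exact ((PiTensorProduct.isEmptyEquiv (Fin 0)).apply_symm_apply (1 : ℂ)).symm
  · refine heq (singletProjAt_mem_singletSpace j (hu (N + 1) α)) (Submodule.zero_mem _) fun β => ?_
    have h1 := linkFunctional_succ q N (β.insert j hj) j (β.mem_insert_self j hj) (u (N + 1) α)
    rw [LinkPattern.remove_insert, huβ, if_neg] at h1
    · rw [← h1, map_zero]
    · rintro rfl
      exact h (β.mem_insert_self j hj)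
  · refine heq (singletProjAt_mem_singletSpace j (hu (N + 1) α)) (hu _ _) fun β => ?_
    have h1 := linkFunctional_succ q N (β.insert j hj) j (β.mem_insert_self j hj) (u (N + 1) α)
    rw [LinkPattern.remove_insert, huβ] at h1
    rw [← h1, huβ]
    refine if_congr ⟨?_, ?_⟩ rfl rfl
    · rintro rfl
      exact (β.remove_insert j hj).symm
    · intro hβ
      exact LinkPattern.remove_injective (β.mem_insert_self j hj) h
        ((β.remove_insert j hj).trans hβ)

theorem IsPureFamily.isSymmetricFamily_sum {u : (N : ℕ) → LinkPattern N → ⨂[ℂ]^(2 * N) M2}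
    (hu : IsPureFamily q u) : IsSymmetricFamily q fun N => ∑ α, u N α where
  normalization := by
    rw [Fintype.sum_unique]
    exact hu.normalization _
  cartan N _ := by rw [map_sum]; exact Finset.sum_congr rfl fun α _ => hu.cartan N α
  highest N _ := by rw [map_sum]; exact Finset.sum_eq_zero fun α _ => hu.highest N α
  proj N j hj := by
    refine (map_sum (singletProjAt q (2 * N) j) (u (N + 1)) Finset.univ).trans ?_
    rw [← LinkPattern.sum_remove (u N) j hj]
    refine Finset.sum_congr rfl fun α _ => ?_
    split_ifs with h
    · exact hu.proj_of_mem N α j hj h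
    · exact hu.proj_of_notMem N α j hj h

end families

/-- If q^n = 1, then 2n = mκ for an integer m, which is nonzero since n is; so κ would be rational.
-/
theorem qOfKappa_pow_ne_one (κ : ℝ) (hκ : Irrational κ) (n : ℕ) (hn : n ≠ 0) :
    (qOfKappa κ hκ : ℂ) ^ n ≠ 1 := by
  intro h
  rw [qOfKappa, ← Complex.exp_nat_mul, Complex.exp_eq_one_iff] at h
  obtain ⟨m, hm⟩ := h
  have hκ0 : (κ : ℂ) ≠ 0 := by exact_mod_cast hκ.ne_zero
  have hπ : (Real.pi : ℂ) ≠ 0 := by exact_mod_cast Real.pi_ne_zero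
  have hI := Complex.I_ne_zero
  have h1 : (2 * n : ℂ) = m * κ := by
    field_simp at hm
    linear_combination hm / 2
  have h2 : (2 * n : ℝ) = m * κ := by exact_mod_cast h1
  have hnR : (n : ℝ) ≠ 0 := by exact_mod_cast hn
  have hmR : (m : ℝ) ≠ 0 := by
    intro h0
    rw [h0, zero_mul] at h2
    exact hnR (by linarith)
  refine hκ ⟨2 * n / m, ?_⟩
  push_cast
  rw [h2]
  field_simp

end QSL2

end

theorem mainTheorem9 (κ : ℝ) (hκ_pos : 0 < κ) (hκ_lt : κ < 8) (hκ : Irrational κ) :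
    (∃! u : (N : ℕ) → QSL2.LinkPattern N → ⨂[ℂ]^(2 * N) QSL2.M2,
      QSL2.IsPureFamily (QSL2.qOfKappa κ hκ) u) ∧
    (∃! v : (N : ℕ) → ⨂[ℂ]^(2 * N) QSL2.M2,
      QSL2.IsSymmetricFamily (QSL2.qOfKappa κ hκ) v) ∧
    ∀ (u : (N : ℕ) → QSL2.LinkPattern N → ⨂[ℂ]^(2 * N) QSL2.M2)
      (v : (N : ℕ) → ⨂[ℂ]^(2 * N) QSL2.M2),
      QSL2.IsPureFamily (QSL2.qOfKappa κ hκ) u →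
        QSL2.IsSymmetricFamily (QSL2.qOfKappa κ hκ) v →
          ∀ N, v N = ∑ α : QSL2.LinkPattern N, u N α := by
  have hq := QSL2.qOfKappa_pow_ne_one κ hκ
  obtain ⟨w, hw⟩ := QSL2.exists_isPureFamily hq
  exact ⟨⟨w, hw, fun _ hu => hu.ext hq hw⟩,
    ⟨_, hw.isSymmetricFamily_sum, fun _ hv => hv.ext hq hw.isSymmetricFamily_sum⟩,
    fun u v hu hv N => congrFun (hv.ext hq hu.isSymmetricFamily_sum) N⟩
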